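/- Let $\mathcal X$ be a (finite-dimensional, second countable) Riemannian manifold with distance $\mathrm{dist}$ and balls $B_\delta(\zeta)=\{x:\mathrm{dist}(x,\zeta)<\delta\}$, let $f:\mathcal X\to\mathcal X$ be Borel measurable, and let $\phi:\mathcal X\to\mathbb R$ be continuous; write $S_p\phi=\sum_{i=0}^{p-1}\phi\circ f^i$. Assume that the pressure $P(\phi)=\sup\{h(\nu)+\int\phi\,d\nu:\ \nu \text{ an } f\text{-invariant Borel probability},\ -\int\phi\,d\nu<\infty\}$ is $0$ ($h$ = metric entropy), that $m$ is a $\phi$-conformal probability measure (i.e. $m(f(A))=\int_A e^{-\phi}\,dm$ for every Borel $A$ on which $f$ is injective), and that $\mu\ll m$ is an equilibrium state for $\phi$ (an $f$-invariant probability with $-\int\phi\,d\mu<\infty$ and $h(\mu)+\int\phi\,d\mu=P(\phi)$). Let $\zeta$ be a repelling periodic point of $f$ of prime period $p\ge1$: $f$ is differentiable at the points of the orbit of $\zeta$, $f^p$ coincides near $\zeta$ with a homeomorphism between open neighbourhoods of $\zeta$, and $\|D(f^p)(\zeta)v\|\ge\kappa\|v\|$ for all tangent vectors $v$ at $\zeta$,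 for some $\kappa>1$. Assume that $\zeta$ lies in the support of $m$ and is a Lebesgue density point of $d\mu/dm$ with value $0<c=\frac{d\mu}{dm}(\zeta)<\infty$, i.e. $\frac1{m(B_r(\zeta))}\int_{B_r(\zeta)}\left|\frac{d\mu}{dm}-c\right|dm\to0$ as $r\to0^+$, and that $\eta\mapsto\mu(B_\eta(\zeta))$ is continuous for small $\eta\ge0$. Let $X_n=\varphi\circ f^n$ with $\varphi(x)=g(\mu(B_{\mathrm{dist}(x,\zeta)}(\zeta)))$, where $g:[0,\infty)\to\mathbb R\cup\{\pm\infty\}$ restricts, for some $v>0$ and $w<g(0)$, to a strictly decreasing bijection $[0,v)\to(w,g(0)]$, and $g\le w$ on $[v,\infty)$. Let $u_F=\sup\{x\in\mathbb R:\mu(X_0\le x)<1\}$ and assume that for all $u<u_F$ sufficiently close to $u_F$ $$\sum_{j=0}^\infty\sup\{|S_p\phi(x)-S_p\phi(\zeta)|:\ x\in\{\varphi>u\}\cap f^{-jp}(\{\varphi>u\})\}<\infty .$$ Let $(u_n)$ be real numbers with $n\,\mu(X_0>u_n)\to\tau$ for some $\tau>0$. Put $Q_{i}(u)=\{X_i>u,\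 X_{i+p}\le u\}$ and $\mathscr Q_{s,\ell}(u)=\bigcap_{i=s}^{s+\ell-1}Q_{i}(u)^c$, and assume that there are non-negative integers $t_n=o(n)$ such that: ($D^p(u_n)$) there is $\gamma(n,t)$, nonincreasing in $t$ for each $n$, with $n\gamma(n,t_n)\to0$ and $|\mu(Q_0(u_n)\cap\mathscr Q_{t,\ell}(u_n))-\mu(Q_0(u_n))\mu(\mathscr Q_{0,\ell}(u_n))|\le\gamma(n,t)$ for all non-negative integers $\ell,t,n$; ($D'_p(u_n)$) there are integers $k_n\to\infty$ with $k_nt_n=o(n)$ and $n\sum_{j=1}^{\lfloor n/k_n\rfloor}\mu(Q_0(u_n)\cap Q_j(u_n))\to0$. Let $\theta=1-e^{S_p\phi(\zeta)}$ and, for a Borel set $A$, let $r_A(x)=\min\{j\ge1:f^j(x)\in A\}$ (with $\min\emptyset=\infty$) and $\mu_A=\mu(\,\cdot\cap A)/\mu(A)$. Then for every sequence $\delta_n>0$ with $\delta_n\to0$, $$\lim_{n\to\infty}\mu\left(r_{B_{\delta_n}(\zeta)}<\frac t{\mu(B_{\delta_n}(\zeta))}\right)=1-e^{-\theta t}\qquad\text{for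 all }t\ge0,$$ $$\lim_{n\to\infty}\mu_{B_{\delta_n}(\zeta)}\left(r_{B_{\delta_n}(\zeta)}<\frac t{\mu(B_{\delta_n}(\zeta))}\right)=(1-\theta)+\theta(1-e^{-\theta t})\qquad\text{for all }t>0.$$ -/

import Mathlib

open MeasureTheory Filter Topology Set
open scoped ENNReal NNReal

noncomputable section

namespace EquilibriumHTS

/-! ### Thermodynamic formalism -/

section Thermodynamics

variable {M : Type*} [MeasurableSpace M]

/-- Shannon entropy of the join `⋁_{i<n} f^{-i} 𝒫`, where the finite partition `𝒫` is the partition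
into the fibres of `ξ : M → Fin k`. -/
def joinEntropy (f : M → M) (ν : Measure M) {k : ℕ} (ξ : M → Fin k) (n : ℕ) : ℝ :=
  ∑ w : Fin n → Fin k, Real.negMulLog (ν.real {x | ∀ i : Fin n, ξ (f^[i] x) = w i})

/-- Kolmogorov–Sinai (metric) entropy of `ν`: the supremum over finite measurable partitions of the
exponential growth rate of the entropies of the joins. -/
def metricEntropy (f : M → M) (ν : Measure M) : ℝ≥0∞ :=
  ⨆ (k : ℕ) (ξ : M → Fin k) (_ : Measurable ξ),
    limsup (fun n : ℕ => ENNReal.ofReal (joinEntropy f ν ξ n / n)) atTop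

/-- `∫ φ dν` as an extended real number, meaningful when the negative part is integrable. -/
def extIntegral (φ : M → ℝ) (ν : Measure M) : EReal :=
  ((∫⁻ x, ENNReal.ofReal (φ x) ∂ν : ℝ≥0∞) : EReal)
    - ((∫⁻ x, ENNReal.ofReal (-φ x) ∂ν : ℝ≥0∞) : EReal)

/-- `ν` is an `f`-invariant probability measure with `-∫ φ dν < ∞`. -/
structure IsAdmissible (f : M → M) (φ : M → ℝ) (ν : Measure M) : Prop where
  prob : IsProbabilityMeasure ν
  invariant : MeasurePreserving f ν ν
  neg_finite : ∫⁻ x, ENNReal.ofReal (-φ x) ∂ν < ⊤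

/-- The pressure `P(φ) = sup {h(ν) + ∫ φ dν}`. -/
def pressure (f : M → M) (φ : M → ℝ) : EReal :=
  ⨆ (ν : Measure M) (_ : IsAdmissible f φ ν), (metricEntropy f ν : EReal) + extIntegral φ ν

/-- `μ` is an equilibrium state for `(M, f, φ)`. -/
structure IsEquilibriumState (f : M → M) (φ : M → ℝ) (μ : Measure M) : Prop
    extends IsAdmissible f φ μ where
  eq_pressure : (metricEntropy f μ : EReal) + extIntegral φ μ = pressure f φ

/-- `m` is a `φ`-conformal measure. -/
structure IsConformal (f : M → M) (φ : M → ℝ) (m : Measure M) : Prop where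
  prob : IsProbabilityMeasure m
  conformal : ∀ A : Set M, MeasurableSet A → InjOn f A →
    m (f '' A) = ∫⁻ x in A, ENNReal.ofReal (Real.exp (-φ x)) ∂m

end Thermodynamics

/-! ### Local hypotheses at the point `ζ` -/

section Local

variable {M : Type*} [MetricSpace M] [MeasurableSpace M]

/-- `ζ` belongs to the support of `m` and is a Lebesgue point of `dμ/dm`, with value
`(dμ/dm)(ζ) = c`. -/
def HasDensityAt (μ m : Measure M) (ζ : M) (c : ℝ) : Prop :=
  (∀ r > 0, 0 < m (Metric.ball ζ r)) ∧
    Tendsto (fun r : ℝ => ⨍ x in Metric.ball ζ r, |(μ.rnDeriv m x).toReal - c| ∂m)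
      (𝓝[>] 0) (𝓝 0)

/-- The function `η ↦ μ(B_η(ζ))` is continuous for small `η ≥ 0`. -/
def ContinuousBallMeasure (μ : Measure M) (ζ : M) : Prop :=
  ∃ η₀ > 0, ContinuousOn (fun η : ℝ => μ.real (Metric.ball ζ η)) (Ico 0 η₀)

/-- The observable `x ↦ g (μ (B_{dist(x,ζ)}(ζ)))`. -/
def observable (μ : Measure M) (ζ : M) (g : ℝ≥0 → EReal) (x : M) : EReal :=
  g (μ (Metric.ball ζ (dist x ζ))).toNNReal

end Local

/-- `g` has a global maximum at `0`, it is a strictly decreasing bijection from a neighbourhood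
`[0, v)` of `0` onto a one-sided neighbourhood `(w, g 0]` of `g 0`, and it stays away from its
maximum outside `[0, v)`. -/
def IsPeakFunction (g : ℝ≥0 → EReal) : Prop :=
  ∃ v > 0, ∃ w < g 0, StrictAntiOn g (Iio v) ∧ BijOn g (Iio v) (Ioc w (g 0)) ∧
    ∀ y, v ≤ y → g y ≤ w

section Repelling

open Bundle Manifold

variable {E : Type*} [NormedAddCommGroup E] [NormedSpace ℝ E]
  {H : Type*} [TopologicalSpace H] (I : ModelWithCorners ℝ E H)
  {M : Type*} [MetricSpace M] [ChartedSpace H M]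
  [RiemannianBundle (fun x : M => TangentSpace I x)]

/-- `ζ` is a repelling periodic point of `f` of prime period `p`: `f` is differentiable along the
orbit, `f^p` has a local inverse branch at `ζ` (it coincides near `ζ` with a homeomorphism between
open neighbourhoods of `ζ`), and `D(f^p)(ζ)` expands the Riemannian norm, that is, the inverse
branch contracts. -/
structure IsRepellingPeriodicPoint (f : M → M) (ζ : M) (p : ℕ) : Prop where
  pos : 0 < p
  period : Function.minimalPeriod f ζ = p
  differentiable : ∀ j < p, MDifferentiableAt I I f (f^[j] ζ)
  localInverse : ∃ e : OpenPartialHomeomorph M M, ζ ∈ e.source ∧ EqOn (f^[p]) e e.source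
  expanding : ∃ κ : ℝ, 1 < κ ∧ ∀ v : TangentSpace I ζ, κ * ‖v‖ ≤ ‖mfderiv I I (f^[p]) ζ v‖

end Repelling

/-! ### The stationary process `X_n = X ∘ f^n` and its conditions -/

section StationaryEvents

variable {M : Type*}

/-- The exceedance event `{X_i > u}`. -/
def exceed (f : M → M) (X : M → EReal) (u : ℝ) (i : ℕ) : Set M :=
  {x | (u : EReal) < X (f^[i] x)}

/-- The escape event `Q_{p,i}(u) = {X_i > u, X_{i+p} ≤ u}`. -/
def escape (f : M → M) (X : M → EReal) (p : ℕ) (u : ℝ) (i : ℕ) : Set M :=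
  {x | (u : EReal) < X (f^[i] x) ∧ X (f^[i + p] x) ≤ u}

/-- No escape between the times `s` and `s + ℓ - 1`: the event `𝒬_{p,s,ℓ}(u)`. -/
def noEscape (f : M → M) (X : M → EReal) (p : ℕ) (u : ℝ) (s ℓ : ℕ) : Set M :=
  {x | ∀ i, s ≤ i → i < s + ℓ → x ∉ escape f X p u i}

variable [MeasurableSpace M]

/-- Condition `D^p(u_n)`, with the sequence `t_n = o(n)` it provides displayed. -/
def CondD (μ : Measure M) (f : M → M) (X : M → EReal) (p : ℕ) (u : ℕ → ℝ) (t : ℕ → ℕ) : Prop :=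
  (fun n => (t n : ℝ)) =o[atTop] (fun n : ℕ => (n : ℝ)) ∧
    ∃ γ : ℕ → ℕ → ℝ, (∀ n, Antitone (γ n)) ∧
      Tendsto (fun n : ℕ => (n : ℝ) * γ n (t n)) atTop (𝓝 0) ∧
      ∀ ℓ s n : ℕ,
        |μ.real (escape f X p (u n) 0 ∩ noEscape f X p (u n) s ℓ)
          - μ.real (escape f X p (u n) 0) * μ.real (noEscape f X p (u n) 0 ℓ)| ≤ γ n s

/-- Condition `D'_p(u_n)`, relative to the sequence `t_n` of `D^p(u_n)`. -/
def CondDPrime (μ : Measure M) (f : M → M) (X : M → EReal) (p : ℕ) (u : ℕ → ℝ) (t : ℕ → ℕ) : Prop :=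
  ∃ k : ℕ → ℕ, Tendsto k atTop atTop ∧
    (fun n => (k n : ℝ) * (t n : ℝ)) =o[atTop] (fun n : ℕ => (n : ℝ)) ∧
    Tendsto (fun n : ℕ => (n : ℝ) * ∑ j ∈ Finset.Icc 1 (n / k n),
      μ.real (escape f X p (u n) 0 ∩ escape f X p (u n) j)) atTop (𝓝 0)

/-- The right endpoint `u_F = sup {x : F(x) < 1}` of the distribution function
`F(x) = μ(X ≤ x)`. -/
def rightEndpoint (μ : Measure M) (X : M → EReal) : EReal :=
  sSup ((fun x : ℝ => (x : EReal)) '' {x : ℝ | μ {y | X y ≤ (x : EReal)} < 1})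

/-- The distortion condition: for all `u` sufficiently close to `u_F` (from below),
`∑_j sup {|S_p φ(x) - S_p φ(ζ)| : x ∈ {X > u} ∩ f^{-jp} {X > u}} < ∞`. -/
def SummableDistortion (μ : Measure M) (f : M → M) (φ : M → ℝ) (X : M → EReal) (p : ℕ) (ζ : M) :
    Prop :=
  ∃ a < rightEndpoint μ X, ∀ u : ℝ, a < (u : EReal) → (u : EReal) < rightEndpoint μ X →
    ∑' j : ℕ, (⨆ x ∈ exceed f X u 0 ∩ exceed f X u (j * p),
      ENNReal.ofReal |birkhoffSum f φ p x - birkhoffSum f φ p ζ|) < ⊤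

end StationaryEvents

/-- The first hitting (or return) time `r_A(x) = min {j ≥ 1 : f^j(x) ∈ A}`, `∞` if there is none. -/
def hittingTime {M : Type*} (f : M → M) (A : Set M) (x : M) : ℕ∞ :=
  ⨅ (j : ℕ) (_ : 1 ≤ j ∧ f^[j] x ∈ A), (j : ℕ∞)

/-- The event `{r_A < t / μ(A)}`. -/
def hitBefore {M : Type*} [MeasurableSpace M] (μ : Measure M) (f : M → M) (A : Set M) (t : ℝ) :
    Set M :=
  {x | ((hittingTime f A x : ℕ∞) : ℝ≥0∞) < ENNReal.ofReal t / μ A}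

end EquilibriumHTS

end

open EquilibriumHTS Bundle

/-!
Conformality identifies `exp (S_p φ ζ)` as the limit of the conditional probability that a point of
a small ball around `ζ` returns to it after time `p`: the repelling branch of `f^p` maps the
returning points bijectively onto the ball, and a Lebesgue point of `dμ/dm` lets `m` and `μ` be
exchanged. So a fraction `θ` of the ball consists of escapes. Escapes do not cluster, by `D'_p`, and
are asymptotically independent, by `D^p`: cutting time into blocks gives them an exponential law.
Avoiding the ball and avoiding escapes from it differ only through the last `p` times. Finally the
return law is the derivative of the hitting law: `k ↦ μ (no visit in [0, k))` is convex, with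
decrements the probabilities of starting in the ball and not returning before time `k`.
-/

namespace EquilibriumHTS

section Polish

theorem isOpen_range_of_isDenseInducing {X Y : Type*} [TopologicalSpace X]
    [WeaklyLocallyCompactSpace X] [TopologicalSpace Y] [T2Space Y] {i : X → Y}
    (hi : IsDenseInducing i) : IsOpen (range i) := by
  refine isOpen_iff_mem_nhds.2 (forall_mem_range.2 fun x => ?_)
  obtain ⟨K, hK, hKx⟩ := exists_compact_mem_nhds x
  have hclosure := hi.closure_image_mem_nhds hKx
  rw [(hK.image hi.continuous).isClosed.closure_eq] at hclosure
  exact mem_of_superset hclosure (image_subset_range i K)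

theorem polishSpace_of_weaklyLocallyCompactSpace (X : Type*) [MetricSpace X]
    [WeaklyLocallyCompactSpace X] [SecondCountableTopology X] : PolishSpace X := by
  have hcoe : IsEmbedding ((↑) : X → UniformSpace.Completion X) :=
    UniformSpace.Completion.coe_isometry.isEmbedding
  have : SecondCountableTopology (UniformSpace.Completion X) :=
    UniformSpace.secondCountable_of_separable _
  have := (isOpen_range_of_isDenseInducing
    (UniformSpace.Completion.isDenseInducing_coe (α := X))).polishSpace
  exact hcoe.toHomeomorph.isClosedEmbedding.polishSpace

end Polish

section RiemannianComparison

open Manifold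

theorem eventually_mul_norm_le_norm_sub_of_hasFDerivWithinAt {E V W : Type*}
    [NormedAddCommGroup E] [NormedSpace ℝ E] [NormedAddCommGroup V] [NormedSpace ℝ V]
    [NormedAddCommGroup W] [NormedSpace ℝ W] {Φ : E → W} {Φ' : E →L[ℝ] W} {s : Set E} {a : E}
    (hΦ : HasFDerivWithinAt Φ Φ' s a) (A : E ≃L[ℝ] V) {κ κ' : ℝ} (hκ : κ' < κ)
    (hexp : ∀ w, κ * ‖A w‖ ≤ ‖Φ' w‖) :
    ∀ᶠ z in 𝓝[s] a, κ' * ‖A (z - a)‖ ≤ ‖Φ z - Φ a‖ := by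
  have hsmall : (fun z => Φ z - Φ a - Φ' (z - a)) =o[𝓝[s] a] fun z => A (z - a) :=
    hΦ.isLittleO.trans_isBigO (A.isBigO_comp_rev _ _)
  filter_upwards [hsmall.def (sub_pos.2 hκ)] with z hz
  have htri := norm_sub_norm_le (Φ' (z - a)) (Φ z - Φ a)
  rw [norm_sub_rev _ (Φ z - Φ a)] at htri
  linarith [hexp (z - a)]

variable {E : Type*} [NormedAddCommGroup E] [NormedSpace ℝ E]
  {H : Type*} [TopologicalSpace H] {I : ModelWithCorners ℝ E H}
  {M : Type*} [MetricSpace M] [ChartedSpace H M]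

/-- The model space is, as a vector space, the tangent space at `x`, the preferred chart at `x`
inducing the identity; this is the identity, and it carries the Riemannian norm at `x` to the
model space. -/
def modelTangentEquiv (I : ModelWithCorners ℝ E H) (x : M) : E ≃L[ℝ] TangentSpace I x :=
  ContinuousLinearEquiv.refl ℝ E

theorem symmL_trivializationAt_self [IsManifold I 1 M] (x : M) (w : E) :
    (trivializationAt E (TangentSpace I) x).symmL ℝ x w = modelTangentEquiv I x w := by
  rw [TangentBundle.symmL_trivializationAt_eq_core (mem_chart_source H x)]
  exact (tangentBundleCore I M).coordChange_self _ _ (mem_chart_source H x) _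

theorem continuousLinearMapAt_trivializationAt_self [IsManifold I 1 M] (x : M) (w : E) :
    (trivializationAt E (TangentSpace I) x).continuousLinearMapAt ℝ x (modelTangentEquiv I x w)
      = w := by
  rw [← symmL_trivializationAt_self]
  exact (trivializationAt E (TangentSpace I) x).continuousLinearMapAt_symmL
    (FiberBundle.mem_baseSet_trivializationAt' x) w

variable [RiemannianBundle (fun x : M => TangentSpace I x)]
  {V : Type*} [NormedAddCommGroup V] [NormedSpace ℝ V]

theorem enorm_sub_le_mul_pathELength {F : M → V} {F' : ∀ y : M, TangentSpace I y →L[ℝ] V}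
    {U : Set M} (hF : ContMDiffOn I 𝓘(ℝ, V) 1 F U)
    (hF' : ∀ y ∈ U, HasMFDerivAt I 𝓘(ℝ, V) F y (F' y)) {r : ℝ≥0} (hr : ∀ y ∈ U, ‖F' y‖ₑ ≤ r)
    {γ : ℝ → M} (hγ : ContMDiffOn 𝓘(ℝ, ℝ) I 1 γ (Icc 0 1)) (hγU : MapsTo γ (Icc 0 1) U) :
    ‖F (γ 1) - F (γ 0)‖ₑ ≤ r * pathELength I γ 0 1 := by
  have hFγ : ContDiffOn ℝ 1 (F ∘ γ) (Icc 0 1) := contMDiffOn_iff_contDiffOn.1 (hF.comp hγ hγU)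
  refine (enorm_sub_le_lintegral_derivWithin_Icc_of_contDiffOn_Icc hFγ zero_le_one).trans ?_
  rw [pathELength_eq_lintegral_mfderivWithin_Icc,
    ← lintegral_const_mul' _ _ ENNReal.coe_ne_top]
  refine setLIntegral_mono' measurableSet_Icc fun t ht => ?_
  have hγ' := (hγ.mdifferentiableOn one_ne_zero t ht).hasMFDerivWithinAt
  have hderiv : HasFDerivWithinAt (F ∘ γ)
      (F' (γ t) ∘L mfderivWithin 𝓘(ℝ, ℝ) I γ (Icc 0 1) t : ℝ →L[ℝ] V) (Icc 0 1) t :=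
    ((hF' _ (hγU ht)).comp_hasMFDerivWithinAt t hγ').hasFDerivWithinAt
  rw [hderiv.hasDerivWithinAt.derivWithin (uniqueDiffOn_Icc zero_lt_one t ht)]
  exact (F' (γ t)).le_of_opENorm_le (hr _ (hγU ht)) _

theorem eventually_enorm_sub_le_mul_edist [IsManifold I 1 M]
    [IsContinuousRiemannianBundle E (fun x : M => TangentSpace I x)] [IsRiemannianManifold I M]
    {F : M → V} {F' : ∀ y : M, TangentSpace I y →L[ℝ] V} {x : M}
    (hF : ContMDiffAt I 𝓘(ℝ, V) 1 F x)
    (hF' : ∀ᶠ y in 𝓝 x, HasMFDerivAt I 𝓘(ℝ, V) F y (F' y)) {r : ℝ≥0}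
    (hr : ∀ᶠ y in 𝓝 x, ‖F' y‖ₑ ≤ r) :
    ∀ᶠ y in 𝓝 x, ‖F y - F x‖ₑ ≤ r * edist x y := by
  obtain ⟨U, hU, hFU⟩ := contMDiffAt_iff_contMDiffOn_nhds (by simp) |>.1 hF
  obtain ⟨ρ, hρ, hρU⟩ := setOfPred_riemannianEDist_lt_subset_nhds I
    (inter_mem hU (hF'.and hr))
  filter_upwards [Metric.eball_mem_nhds x (ENNReal.coe_pos.2 hρ)] with y hy
  rw [Metric.mem_eball, edist_comm] at hy
  have hlength : ∀ L ∈ Ioo (edist x y) ρ, ‖F y - F x‖ₑ ≤ r * L := fun L hL => by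
    rw [IsRiemannianManifold.out (I := I) x y] at hL
    obtain ⟨γ, rfl, rfl, hγ, hγL⟩ := exists_lt_of_riemannianEDist_lt hL.1
    have hγU : MapsTo γ (Icc 0 1) _ := fun t ht => hρU <|
      calc riemannianEDist I (γ 0) (γ t)
        _ ≤ pathELength I γ 0 t := riemannianEDist_le_pathELength
            (hγ.mono (Icc_subset_Icc_right ht.2)) rfl rfl ht.1
        _ ≤ pathELength I γ 0 1 := pathELength_mono le_rfl ht.2
        _ < ρ := hγL.trans hL.2
    exact (enorm_sub_le_mul_pathELength (hFU.mono inter_subset_left) (fun z hz => hz.2.1)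
      (fun z hz => hz.2.2) hγ hγU).trans (by gcongr)
  have hlim : Tendsto (fun L => (r : ℝ≥0∞) * L) (𝓝[>] (edist x y)) (𝓝 (r * edist x y)) :=
    (ENNReal.Tendsto.const_mul tendsto_id (.inr ENNReal.coe_ne_top)).mono_left nhdsWithin_le_nhds
  have : (𝓝[>] (edist x y)).NeBot := nhdsGT_neBot_of_exists_gt ⟨_, hy⟩
  exact ge_of_tendsto hlim (eventually_of_mem (Ioo_mem_nhdsGT hy) hlength)

theorem riemannianEDist_le_of_segment {G : V → M} {G' : ∀ z : V, V →L[ℝ] TangentSpace I (G z)}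
    {s : Set V} (hG : ContMDiffOn 𝓘(ℝ, V) I 1 G s)
    (hG' : ∀ z ∈ s, HasMFDerivWithinAt 𝓘(ℝ, V) I G s z (G' z)) {a b : V}
    (hab : segment ℝ a b ⊆ s) {C : ℝ≥0∞} (hC : ∀ z ∈ segment ℝ a b, ‖G' z (b - a)‖ₑ ≤ C) :
    riemannianEDist I (G a) (G b) ≤ C := by
  let η : ℝ →ᴬ[ℝ] V := ContinuousAffineMap.lineMap a b
  have hη : MapsTo η (Icc (0 : ℝ) 1) (segment ℝ a b) := by
    rw [segment_eq_image_lineMap]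
    exact mapsTo_image _ _
  have hGη : ContMDiffOn 𝓘(ℝ, ℝ) I 1 (G ∘ η) (Icc 0 1) :=
    hG.comp (contMDiff_iff_contDiff.2 η.contDiff).contMDiffOn (hη.mono_right hab)
  have hlength : riemannianEDist I (G a) (G b) ≤ pathELength I (G ∘ η) 0 1 :=
    riemannianEDist_le_pathELength hGη (congrArg G (AffineMap.lineMap_apply_zero a b))
      (congrArg G (AffineMap.lineMap_apply_one a b)) zero_le_one
  refine hlength.trans ?_
  rw [pathELength_eq_lintegral_mfderivWithin_Icc]
  refine (setLIntegral_mono' measurableSet_Icc (g := fun _ => C) fun t ht => ?_).trans (by simp)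
  have hη' : HasMFDerivWithinAt 𝓘(ℝ, ℝ) 𝓘(ℝ, V) η (Icc 0 1) t
      (ContinuousLinearMap.toSpanSingleton ℝ (b - a)) :=
    (AffineMap.hasDerivWithinAt_lineMap (a := a) (b := b)).hasFDerivWithinAt.hasMFDerivWithinAt
  have hderiv := (hG' _ (hab (hη ht))).comp t hη' (hη.mono_right hab).subset_preimage
  rw [hderiv.mfderivWithin (uniqueDiffOn_Icc zero_lt_one t ht).uniqueMDiffWithinAt]
  have hone : ContinuousLinearMap.toSpanSingleton ℝ (b - a) (1 : ℝ) = b - a := one_smul ℝ _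
  exact (congrArg (fun w : V => ‖G' (η t) w‖ₑ) hone).trans_le (hC _ (hη ht))

variable [IsManifold I 1 M]
variable [IsContinuousRiemannianBundle E (fun x : M => TangentSpace I x)]

theorem eventually_norm_mfderivWithin_extChartAt_symm_le (x : M) {r : ℝ} (hr : 1 < r) :
    ∀ᶠ z in 𝓝[range I] (extChartAt I x x), ∀ w : E,
      ‖(mfderivWithin 𝓘(ℝ, E) I (extChartAt I x).symm (range I) z w)‖
        ≤ r * ‖modelTangentEquiv I x w‖ := by
  have hnear : ∀ᶠ y in 𝓝 x, y ∈ (chartAt H x).source ∧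
      ‖(trivializationAt E (TangentSpace I) x).symmL ℝ y ∘L
        (trivializationAt E (TangentSpace I) x).continuousLinearMapAt ℝ x‖ < r :=
    (eventually_mem_set.2 (chart_source_mem_nhds H x)).and
      (eventually_norm_symmL_trivializationAt_comp_self_lt E (fun x : M => TangentSpace I x) x hr)
  have hsymm : Tendsto (extChartAt I x).symm (𝓝[range I] (extChartAt I x x)) (𝓝 x) := by
    have := (continuousAt_extChartAt_symm (I := I) x).tendsto
    rw [extChartAt_to_inv] at this
    exact this.mono_left nhdsWithin_le_nhds
  filter_upwards [hsymm.eventually hnear, extChartAt_target_mem_nhdsWithin x] with z hz hzt w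
  have h := ContinuousLinearMap.le_of_opNorm_le _ hz.2.le (modelTangentEquiv I x w)
  rw [ContinuousLinearMap.comp_apply, continuousLinearMapAt_trivializationAt_self,
    TangentBundle.symmL_trivializationAt hz.1, (extChartAt I x).right_inv hzt] at h
  exact h

variable [IsRiemannianManifold I M]

theorem eventually_edist_le_enorm_extChartAt_sub (x : M) {r : ℝ≥0} (hr : 1 < r) :
    ∀ᶠ y in 𝓝 x,
      edist x y ≤ r * ‖modelTangentEquiv I x (extChartAt I x y - extChartAt I x x)‖ₑ := by
  obtain ⟨ρ, hρ, hρs⟩ := Metric.mem_nhdsWithin_iff.1 (inter_mem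
    (extChartAt_target_mem_nhdsWithin (I := I) x)
    (eventually_norm_mfderivWithin_extChartAt_symm_le (I := I) x (NNReal.coe_lt_coe.2 hr)))
  filter_upwards [chart_source_mem_nhds H x, (continuousAt_extChartAt (I := I) x).eventually
    (Metric.ball_mem_nhds _ hρ)] with y hy hyρ
  have hseg : segment ℝ (extChartAt I x x) (extChartAt I x y) ⊆ Metric.ball _ ρ ∩ range I :=
    ((convex_ball _ ρ).inter I.convex_range).segment_subset
      ⟨Metric.mem_ball_self hρ, mem_range_self _⟩ ⟨hyρ, mem_range_self _⟩
  have h := riemannianEDist_le_of_segment (I := I) (contMDiffOn_extChartAt_symm x)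
    (fun z hz => (mdifferentiableWithinAt_extChartAt_symm hz).hasMFDerivWithinAt.mono
      (extChartAt_target_subset_range x))
    (hseg.trans (hρs.trans inter_subset_left))
    (C := r * ‖modelTangentEquiv I x (extChartAt I x y - extChartAt I x x)‖ₑ) fun z hz => ?_
  · rwa [(extChartAt I x).left_inv (mem_extChartAt_source x),
      (extChartAt I x).left_inv (by rwa [extChartAt_source]),
      ← IsRiemannianManifold.out (I := I)] at h
  · rw [← ofReal_norm, ← ofReal_norm, ← ENNReal.ofReal_coe_nnreal,
      ← ENNReal.ofReal_mul r.coe_nonneg]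
    exact ENNReal.ofReal_le_ofReal ((hρs (hseg hz)).2 _)

theorem eventually_enorm_extChartAt_sub_le_edist (x : M) {r : ℝ≥0} (hr : 1 < r) :
    ∀ᶠ y in 𝓝 x,
      ‖modelTangentEquiv I x (extChartAt I x y - extChartAt I x x)‖ₑ ≤ r * edist x y := by
  let F : M → TangentSpace I x := fun y => modelTangentEquiv I x (extChartAt I x y)
  have hF : ContMDiffAt I 𝓘(ℝ, TangentSpace I x) 1 F x :=
    (modelTangentEquiv I x : E →L[ℝ] TangentSpace I x).contMDiff.contMDiffAt.comp x
      contMDiffAt_extChartAt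
  have hF' : ∀ᶠ y in 𝓝 x, HasMFDerivAt I 𝓘(ℝ, TangentSpace I x) F y
      ((trivializationAt E (TangentSpace I) x).symmL ℝ x ∘L
        (trivializationAt E (TangentSpace I) x).continuousLinearMapAt ℝ y) := by
    filter_upwards [chart_source_mem_nhds H x] with y hy
    have hsymm : (trivializationAt E (TangentSpace I) x).symmL ℝ x = modelTangentEquiv I x :=
      ContinuousLinearMap.ext (symmL_trivializationAt_self x)
    rw [TangentBundle.continuousLinearMapAt_trivializationAt hy, hsymm]
    exact (modelTangentEquiv I x : E →L[ℝ] TangentSpace I x).hasMFDerivAt.comp y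
      (mdifferentiableAt_extChartAt hy).hasMFDerivAt
  have hr' : ∀ᶠ y in 𝓝 x, ‖(trivializationAt E (TangentSpace I) x).symmL ℝ x ∘L
        (trivializationAt E (TangentSpace I) x).continuousLinearMapAt ℝ y‖ₑ ≤ r := by
    filter_upwards [eventually_norm_symmL_trivializationAt_self_comp_lt E
      (fun x : M => TangentSpace I x) x (NNReal.coe_lt_coe.2 hr)] with y hy
    exact enorm_le_coe.2 hy.le
  simpa only [F, map_sub] using eventually_enorm_sub_le_mul_edist hF hF' hr'

theorem eventually_dist_le_dist_of_expanding {h : M → M} {x : M} (hh : MDifferentiableAt I I h x)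
    {κ : ℝ} (hκ : 1 < κ) (hexp : ∀ v : TangentSpace I x, κ * ‖v‖ ≤ ‖mfderiv I I h x v‖) :
    ∀ᶠ y in 𝓝 x, dist y x ≤ dist (h y) (h x) := by
  obtain ⟨r, hr, hrκ⟩ : ∃ r : ℝ≥0, 1 < r ∧ (r : ℝ) ^ 2 < κ := by
    obtain ⟨r, hr, hrκ⟩ := exists_between
      (show 1 < √κ from Real.lt_sqrt_of_sq_lt (by simpa using hκ))
    lift r to ℝ≥0 using zero_le_one.trans hr.le
    exact ⟨r, NNReal.one_lt_coe.1 hr, (Real.lt_sqrt r.coe_nonneg).1 hrκ⟩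
  let Φ : E → TangentSpace I (h x) := modelTangentEquiv I (h x) ∘ writtenInExtChartAt I I x h
  have hΦ : HasFDerivWithinAt Φ ((modelTangentEquiv I (h x) : E →L[ℝ] TangentSpace I (h x)) ∘L
      (mfderiv I I h x : E →L[ℝ] E)) (range I) (extChartAt I x x) :=
    (modelTangentEquiv I (h x)).hasFDerivAt.comp_hasFDerivWithinAt _ hh.hasMFDerivAt.2
  have hΦexp := eventually_mul_norm_le_norm_sub_of_hasFDerivWithinAt hΦ (modelTangentEquiv I x)
    hrκ hexp
  filter_upwards [extChartAt_preimage_mem_nhds_of_mem_nhdsWithin (by simp) hΦexp,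
    chart_source_mem_nhds H x,
    eventually_edist_le_enorm_extChartAt_sub (I := I) x hr,
    hh.continuousAt.eventually (eventually_enorm_extChartAt_sub_le_edist (I := I) (h x) hr)]
    with y hexpand hsource hupper hlower
  replace hupper :
      dist y x ≤ r * ‖modelTangentEquiv I x (extChartAt I x y - extChartAt I x x)‖ := by
    rw [edist_comm, edist_nndist, enorm_eq_nnnorm] at hupper
    exact_mod_cast hupper
  replace hlower : ‖Φ (extChartAt I x y) - Φ (extChartAt I x x)‖ ≤ r * dist (h y) (h x) := by
    rw [edist_comm, edist_nndist, enorm_eq_nnnorm] at hlower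
    simp only [Φ, Function.comp_apply, writtenInExtChartAt, extChartAt_to_inv,
      (extChartAt I x).left_inv (by rwa [extChartAt_source]), ← map_sub]
    exact_mod_cast hlower
  have : (r : ℝ) * dist y x ≤ r * dist (h y) (h x) := by
    calc (r : ℝ) * dist y x
      _ ≤ r * (r * ‖modelTangentEquiv I x (extChartAt I x y - extChartAt I x x)‖) := by gcongr
      _ = r ^ 2 * ‖modelTangentEquiv I x (extChartAt I x y - extChartAt I x x)‖ := by ring
      _ ≤ ‖Φ (extChartAt I x y) - Φ (extChartAt I x x)‖ := hexpand
      _ ≤ r * dist (h y) (h x) := hlower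
  exact le_of_mul_le_mul_left this (by positivity)

end RiemannianComparison

section Conformal

variable {M : Type*} [MeasurableSpace M] {f : M → M} {φ : M → ℝ} {m : Measure M}

theorem measurable_birkhoffSum (hf : Measurable f) (hφ : Measurable φ) (k : ℕ) :
    Measurable (birkhoffSum f φ k) :=
  Finset.measurable_fun_sum _ fun i _ => hφ.comp (hf.iterate i)

theorem IsConformal.lintegral_image (hm : IsConformal f φ m) (hf : Measurable f)
    (hφ : Measurable φ) {A : Set M} (hA : MeasurableSet A) (hinj : InjOn f A) {h : M → ℝ≥0∞}
    (hh : Measurable h) :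
    ∫⁻ y in f '' A, h y ∂m = ∫⁻ x in A, ENNReal.ofReal (Real.exp (-φ x)) * h (f x) ∂m := by
  have hmap : m.restrict (f '' A) =
      ((m.restrict A).withDensity fun x => ENNReal.ofReal (Real.exp (-φ x))).map f := by
    ext B hB
    rw [Measure.restrict_apply hB, Measure.map_apply hf hB, withDensity_apply _ (hf hB),
      Measure.restrict_restrict (hf hB), inter_comm B, ← image_inter_preimage, inter_comm A]
    exact hm.conformal _ ((hf hB).inter hA) (hinj.mono inter_subset_right)
  rw [hmap, lintegral_map hh hf]
  exact lintegral_withDensity_eq_lintegral_mul _ (by fun_prop) (hh.comp hf)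

theorem IsConformal.iterate [StandardBorelSpace M] (hm : IsConformal f φ m) (hf : Measurable f)
    (hφ : Measurable φ) (k : ℕ) : IsConformal f^[k] (birkhoffSum f φ k) m := by
  refine ⟨hm.prob, ?_⟩
  induction k with
  | zero => simp
  | succ k ih =>
    intro A hA hinj
    have hinj_f : InjOn f A := InjOn.of_comp (g := f^[k]) hinj
    have hinj_iterate : InjOn f^[k] (f '' A) := InjOn.image_of_comp hinj
    have := measurable_birkhoffSum hf hφ k
    rw [Function.iterate_succ, image_comp, ih _ (hA.image_of_measurable_injOn hf hinj_f)
      hinj_iterate, hm.lintegral_image hf hφ hA hinj_f (by fun_prop)]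
    refine lintegral_congr fun x => ?_
    rw [← ENNReal.ofReal_mul (Real.exp_nonneg _), ← Real.exp_add, birkhoffSum_succ', neg_add]

theorem IsConformal.measureReal_image (hm : IsConformal f φ m) (hφ : Measurable φ) {A : Set M}
    (hA : MeasurableSet A) (hinj : InjOn f A) :
    m.real (f '' A) = ∫ x in A, Real.exp (-φ x) ∂m := by
  rw [integral_eq_lintegral_of_nonneg_ae (.of_forall fun _ => Real.exp_nonneg _)
    (by fun_prop), ← hm.conformal A hA hinj, Measure.real]

theorem IsConformal.tendsto_measureReal_div_image [TopologicalSpace M] [OpensMeasurableSpace M]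
    (hm : IsConformal f φ m) (hφ : Measurable φ) {x : M} (hφx : ContinuousAt φ x)
    {ι : Type*} {l : Filter ι} {s : ι → Set M} (hs : Tendsto s l (𝓝 x).smallSets)
    (hmeas : ∀ i, MeasurableSet (s i)) (hinj : ∀ᶠ i in l, InjOn f (s i))
    (hne : ∀ᶠ i in l, m.real (f '' s i) ≠ 0) :
    Tendsto (fun i => m.real (s i) / m.real (f '' s i)) l (𝓝 (Real.exp (φ x))) := by
  have := hm.prob
  have hlittle : (fun i => m.real (f '' s i) - m.real (s i) * Real.exp (-φ x)) =o[l]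
      fun i => m.real (s i) * Real.exp (-φ x) := by
    have hint := (hφx.neg.rexp).integral_sub_linear_isLittleO_ae (μ := m)
      (Measurable.stronglyMeasurable (by fun_prop)).stronglyMeasurableAtFilter hs
    refine (hint.congr' ?_ .rfl).trans_isBigO
      (Asymptotics.isBigO_self_const_mul (Real.exp_ne_zero (-φ x)) _ _) |>.congr_right
        fun i => mul_comm _ _
    filter_upwards [hinj] with i hi
    rw [hm.measureReal_image hφ (hmeas i) hi, smul_eq_mul]
    rfl
  have hequiv : Asymptotics.IsEquivalent l (fun i => m.real (s i) * Real.exp (-φ x))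
      fun i => m.real (f '' s i) := Asymptotics.IsEquivalent.symm hlittle
  have hone := ((Asymptotics.isEquivalent_iff_tendsto_one hne).1 hequiv).mul_const
    (Real.exp (φ x))
  rw [one_mul] at hone
  refine hone.congr fun i => ?_
  rw [Pi.div_apply, mul_div_right_comm, mul_assoc, ← Real.exp_add, neg_add_cancel, Real.exp_zero,
    mul_one]

end Conformal

section PeriodicPoint

variable {M : Type*} [MetricSpace M]

theorem continuousAt_birkhoffSum {f : M → M} {φ : M → ℝ} (hφ : Continuous φ) {ζ : M} {p : ℕ}
    (hf : ∀ j < p, ContinuousAt f^[j] ζ) : ContinuousAt (birkhoffSum f φ p) ζ :=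
  tendsto_finsetSum _ fun j hj => hφ.continuousAt.comp (hf j (Finset.mem_range.1 hj))

/-- The metric content of a repelling periodic point: `f^p` fixes `ζ`, has a local inverse branch
there, and brings no point near `ζ` closer to it. The period `p` need not be minimal. -/
structure IsExpandingPeriodicPoint (f : M → M) (ζ : M) (p : ℕ) : Prop where
  pos : 0 < p
  isFixedPt : f^[p] ζ = ζ
  localInverse : ∃ e : OpenPartialHomeomorph M M, ζ ∈ e.source ∧ EqOn f^[p] e e.source
  dist_le : ∀ᶠ y in 𝓝 ζ, dist y ζ ≤ dist (f^[p] y) ζ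

variable {f : M → M} {ζ : M} {p : ℕ}

theorem IsExpandingPeriodicPoint.eventually_injOn (hζ : IsExpandingPeriodicPoint f ζ p) :
    ∀ᶠ s in (𝓝 ζ).smallSets, InjOn f^[p] s := by
  obtain ⟨e, heζ, he⟩ := hζ.localInverse
  filter_upwards [eventually_smallSets_subset.2 (e.open_source.mem_nhds heζ)] with s hs
  exact (e.injOn.congr he.symm).mono hs

theorem IsExpandingPeriodicPoint.eventually_image_ball_inter_preimage
    (hζ : IsExpandingPeriodicPoint f ζ p) :
    ∀ᶠ r in 𝓝[>] (0 : ℝ),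
      f^[p] '' (Metric.ball ζ r ∩ f^[p] ⁻¹' Metric.ball ζ r) = Metric.ball ζ r := by
  obtain ⟨e, heζ, he⟩ := hζ.localInverse
  have hfix : e ζ = ζ := (he heζ).symm.trans hζ.isFixedPt
  have htarget : e.target ∈ 𝓝 ζ :=
    e.open_target.mem_nhds (by simpa only [hfix] using e.map_source heζ)
  have hsymm : Tendsto e.symm (𝓝 ζ) (𝓝 ζ) := by
    simpa only [hfix] using e.tendsto_symm heζ
  obtain ⟨r₀, hr₀, hball⟩ := Metric.eventually_nhds_iff_ball.1
    ((eventually_mem_set.2 htarget).and (hsymm.eventually hζ.dist_le))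
  filter_upwards [Ioo_mem_nhdsGT hr₀] with r hr
  refine Subset.antisymm (image_subset_iff.2 inter_subset_right) fun y hy => ?_
  obtain ⟨hytarget, hydist⟩ := hball y (Metric.ball_subset_ball hr.2.le hy)
  have hpre : f^[p] (e.symm y) = y := by
    rw [he (e.map_target hytarget), e.right_inv hytarget]
  rw [hpre] at hydist
  exact ⟨e.symm y, ⟨hydist.trans_lt hy, by rwa [mem_preimage, hpre]⟩, hpre⟩

end PeriodicPoint

section Density

variable {M : Type*} [MetricSpace M] [MeasurableSpace M] {m μ : Measure M} {ζ : M} {c : ℝ}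

theorem HasDensityAt.measureReal_ball_pos [IsFiniteMeasure m] (h : HasDensityAt μ m ζ c) {r : ℝ}
    (hr : 0 < r) : 0 < m.real (Metric.ball ζ r) :=
  ENNReal.toReal_pos (h.1 r hr).ne' (measure_ne_top _ _)

theorem HasDensityAt.tendsto_sub_div [IsFiniteMeasure μ] [IsFiniteMeasure m]
    (h : HasDensityAt μ m ζ c) (hμm : μ ≪ m) {A : ℝ → Set M} (hA : ∀ r, A r ⊆ Metric.ball ζ r) :
    Tendsto (fun r => (μ.real (A r) - c * m.real (A r)) / m.real (Metric.ball ζ r))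
      (𝓝[>] 0) (𝓝 0) := by
  refine squeeze_zero_norm (fun r => ?_) h.2
  have hint : Integrable (fun x => (μ.rnDeriv m x).toReal - c) m :=
    Measure.integrable_toReal_rnDeriv.sub (integrable_const c)
  have hsub : μ.real (A r) - c * m.real (A r) = ∫ x in A r, ((μ.rnDeriv m x).toReal - c) ∂m := by
    rw [integral_sub Measure.integrable_toReal_rnDeriv.integrableOn (integrable_const c),
      Measure.setIntegral_toReal_rnDeriv hμm, setIntegral_const, smul_eq_mul, mul_comm c]
  rw [hsub, setAverage_eq, smul_eq_mul, norm_div, div_eq_inv_mul,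
    Real.norm_of_nonneg measureReal_nonneg]
  gcongr
  exact (norm_integral_le_integral_norm _).trans
    (setIntegral_mono_set hint.abs.integrableOn (.of_forall fun _ => abs_nonneg _)
      (hA r).eventuallyLE)

theorem HasDensityAt.tendsto_div [IsFiniteMeasure μ] [IsFiniteMeasure m]
    (h : HasDensityAt μ m ζ c) (hμm : μ ≪ m) {A : ℝ → Set M} (hA : ∀ r, A r ⊆ Metric.ball ζ r)
    {a : ℝ}
    (ha : Tendsto (fun r => m.real (A r) / m.real (Metric.ball ζ r)) (𝓝[>] 0) (𝓝 a)) :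
    Tendsto (fun r => μ.real (A r) / m.real (Metric.ball ζ r)) (𝓝[>] 0) (𝓝 (c * a)) := by
  have hadd := (h.tendsto_sub_div hμm hA).add (ha.const_mul c)
  rw [zero_add] at hadd
  exact hadd.congr fun r => by ring

theorem HasDensityAt.tendsto_ball_div [IsFiniteMeasure μ] [IsFiniteMeasure m]
    (h : HasDensityAt μ m ζ c) (hμm : μ ≪ m) :
    Tendsto (fun r => μ.real (Metric.ball ζ r) / m.real (Metric.ball ζ r)) (𝓝[>] 0) (𝓝 c) := by
  have hself : Tendsto (fun r => m.real (Metric.ball ζ r) / m.real (Metric.ball ζ r))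
      (𝓝[>] 0) (𝓝 1) := tendsto_const_nhds.congr' <| by
    filter_upwards [self_mem_nhdsWithin] with r hr
    rw [div_self (h.measureReal_ball_pos hr).ne']
  simpa only [mul_one] using h.tendsto_div hμm (fun _ => Subset.rfl) hself

theorem HasDensityAt.measureReal_ball_pos_of_absolutelyContinuous [IsFiniteMeasure μ]
    [IsFiniteMeasure m] (h : HasDensityAt μ m ζ c) (hc : 0 < c) (hμm : μ ≪ m) {r : ℝ}
    (hr : 0 < r) : 0 < μ.real (Metric.ball ζ r) := by
  obtain ⟨r', hdiv, hr'⟩ :=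
    (((h.tendsto_ball_div hμm).eventually_const_lt hc).and (Ioo_mem_nhdsGT hr)).exists
  exact ((div_pos_iff_of_pos_right (h.measureReal_ball_pos hr'.1)).1 hdiv).trans_le
    (measureReal_mono (Metric.ball_subset_ball hr'.2.le))

theorem IsExpandingPeriodicPoint.tendsto_return_ratio [OpensMeasurableSpace M]
    [StandardBorelSpace M] [IsFiniteMeasure μ] {f : M → M} {p : ℕ}
    (hζ : IsExpandingPeriodicPoint f ζ p) (hf : Measurable f) {φ : M → ℝ} (hφ : Measurable φ)
    (hS : ContinuousAt (birkhoffSum f φ p) ζ) (hm : IsConformal f φ m) (hμm : μ ≪ m) (hc : c ≠ 0)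
    (hdens : HasDensityAt μ m ζ c) :
    Tendsto (fun r => μ.real (Metric.ball ζ r ∩ f^[p] ⁻¹' Metric.ball ζ r)
        / μ.real (Metric.ball ζ r)) (𝓝[>] 0) (𝓝 (Real.exp (birkhoffSum f φ p ζ))) := by
  have := hm.prob
  have hball : Tendsto (fun r => Metric.ball ζ r ∩ f^[p] ⁻¹' Metric.ball ζ r) (𝓝[>] 0)
      (𝓝 ζ).smallSets :=
    (tendsto_smallSets_iff.2 fun t ht => by
      obtain ⟨r₀, hr₀, hsub⟩ := Metric.mem_nhds_iff.1 ht
      filter_upwards [Ioo_mem_nhdsGT hr₀] with r hr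
      exact inter_subset_left.trans ((Metric.ball_subset_ball hr.2.le).trans hsub))
  have himage := hζ.eventually_image_ball_inter_preimage
  have hconf := (hm.iterate hf hφ p).tendsto_measureReal_div_image
    (measurable_birkhoffSum hf hφ p) hS hball
    (fun r => Metric.isOpen_ball.measurableSet.inter
      (hf.iterate p Metric.isOpen_ball.measurableSet))
    (hball.eventually hζ.eventually_injOn) (by
      filter_upwards [himage, self_mem_nhdsWithin] with r hr hr0
      rw [hr]
      exact (hdens.measureReal_ball_pos hr0).ne')
  have hratio := (hdens.tendsto_div hμm (fun _ => inter_subset_left)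
    (hconf.congr' (himage.mono fun r hr => by rw [hr]))).div (hdens.tendsto_ball_div hμm) hc
  rw [mul_div_cancel_left₀ _ hc] at hratio
  refine hratio.congr' ?_
  filter_upwards [self_mem_nhdsWithin] with r hr
  exact div_div_div_cancel_right₀ (hdens.measureReal_ball_pos hr).ne' _ _

end Density

section Manifold

variable {E : Type*} [NormedAddCommGroup E] [NormedSpace ℝ E]
  {H : Type*} [TopologicalSpace H] {I : ModelWithCorners ℝ E H}

theorem mdifferentiableAt_iterate {M : Type*} [TopologicalSpace M] [ChartedSpace H M] {f : M → M}
    {x : M} {p : ℕ} (h : ∀ j < p, MDifferentiableAt I I f (f^[j] x)) :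
    MDifferentiableAt I I f^[p] x := by
  induction p with
  | zero => exact mdifferentiableAt_id
  | succ p ih =>
    rw [Function.iterate_succ']
    exact (h p p.lt_succ_self).comp x (ih fun j hj => h j (hj.trans p.lt_succ_self))

theorem IsRepellingPeriodicPoint.isExpandingPeriodicPoint {M : Type*} [MetricSpace M]
    [ChartedSpace H M] [IsManifold I 1 M] [RiemannianBundle (fun x : M => TangentSpace I x)]
    [IsContinuousRiemannianBundle E (fun x : M => TangentSpace I x)] [IsRiemannianManifold I M]
    {f : M → M} {ζ : M} {p : ℕ} (hζ : IsRepellingPeriodicPoint I f ζ p) :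
    IsExpandingPeriodicPoint f ζ p := by
  have hfix : f^[p] ζ = ζ := hζ.period ▸ Function.iterate_minimalPeriod
  obtain ⟨κ, hκ, hexp⟩ := hζ.expanding
  have hdist := eventually_dist_le_dist_of_expanding
    (mdifferentiableAt_iterate hζ.differentiable) hκ hexp
  rw [hfix] at hdist
  exact ⟨hζ.pos, hfix, hζ.localInverse, hdist⟩

theorem IsRepellingPeriodicPoint.continuousAt_birkhoffSum {M : Type*} [MetricSpace M]
    [ChartedSpace H M] [RiemannianBundle (fun x : M => TangentSpace I x)] {f : M → M} {ζ : M}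
    {p : ℕ} (hζ : IsRepellingPeriodicPoint I f ζ p) {φ : M → ℝ} (hφ : Continuous φ) :
    ContinuousAt (birkhoffSum f φ p) ζ :=
  EquilibriumHTS.continuousAt_birkhoffSum hφ fun _ hj =>
    (mdifferentiableAt_iterate fun i hi => hζ.differentiable i (hi.trans hj)).continuousAt

end Manifold

section Avoid

variable {M : Type*} {f : M → M} {Q : Set M}

/-- The event that the orbit stays outside `Q` during the `ℓ` times `s, …, s + ℓ - 1`. -/
def avoid (f : M → M) (Q : Set M) (s ℓ : ℕ) : Set M :=
  {x | ∀ i, s ≤ i → i < s + ℓ → f^[i] x ∉ Q}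

theorem avoid_zero (s : ℕ) : avoid f Q s 0 = univ :=
  eq_univ_of_forall fun _ _ hsi his => absurd his hsi.not_gt

theorem preimage_iterate_avoid (k s ℓ : ℕ) :
    f^[k] ⁻¹' avoid f Q s ℓ = avoid f Q (s + k) ℓ := by
  ext x
  simp only [avoid, mem_preimage, mem_ofPred_eq, ← Function.iterate_add_apply]
  refine ⟨fun h i hsi his => ?_, fun h i hsi his => h (i + k) (by omega) (by omega)⟩
  simpa only [Nat.sub_add_cancel (le_of_add_le_right hsi)] using h (i - k) (by omega) (by omega)

theorem avoid_add (s a b : ℕ) : avoid f Q s (a + b) = avoid f Q s a ∩ avoid f Q (s + a) b := by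
  ext x
  refine ⟨fun h => ⟨fun i hsi hi => h i hsi (by omega), fun i hsi hi => h i (by omega) (by omega)⟩,
    fun h i hsi hi => ?_⟩
  exact (lt_or_ge i (s + a)).elim (h.1 i hsi) fun hai => h.2 i hai (by omega)

theorem avoid_one (s : ℕ) : avoid f Q s 1 = (f^[s] ⁻¹' Q)ᶜ := by
  ext x
  refine ⟨fun h => h s le_rfl s.lt_succ_self, fun h i hsi his => ?_⟩
  rwa [Nat.eq_of_le_of_lt_succ hsi his]

theorem avoid_succ (s a : ℕ) : avoid f Q s (a + 1) = avoid f Q s a \ f^[s + a] ⁻¹' Q := by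
  rw [avoid_add, avoid_one, sdiff_eq]

theorem avoid_subset_avoid (s : ℕ) {a b : ℕ} (h : a ≤ b) : avoid f Q s b ⊆ avoid f Q s a :=
  fun _ hx i hsi hi => hx i hsi (hi.trans_le (Nat.add_le_add_left h s))

variable [MeasurableSpace M]

theorem measurableSet_avoid (hf : Measurable f) (hQ : MeasurableSet Q) (s ℓ : ℕ) :
    MeasurableSet (avoid f Q s ℓ) := by
  induction ℓ with
  | zero => rw [avoid_zero]; exact .univ
  | succ ℓ ih => rw [avoid_succ]; exact ih.diff (hf.iterate _ hQ)

variable {μ : Measure M}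

theorem measureReal_preimage_iterate (hf : MeasurePreserving f μ μ) (hQ : MeasurableSet Q)
    (k : ℕ) : μ.real (f^[k] ⁻¹' Q) = μ.real Q :=
  (hf.iterate k).measureReal_preimage hQ.nullMeasurableSet

theorem measureReal_avoid_eq_zero_start (hf : MeasurePreserving f μ μ) (hQ : MeasurableSet Q)
    (s ℓ : ℕ) : μ.real (avoid f Q s ℓ) = μ.real (avoid f Q 0 ℓ) := by
  rw [← measureReal_preimage_iterate hf (measurableSet_avoid hf.measurable hQ 0 ℓ) s,
    preimage_iterate_avoid, zero_add]

theorem abs_sum_measureReal_preimage_inter_avoid_sub_le (hf : MeasurePreserving f μ μ)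
    (hQ : MeasurableSet Q) {b t N : ℕ} {γ : ℝ}
    (hγ : ∀ s ≥ t, |μ.real (Q ∩ avoid f Q s N) - μ.real Q * μ.real (avoid f Q 0 N)| ≤ γ) :
    |∑ i ∈ Finset.range b, μ.real (f^[i] ⁻¹' Q ∩ avoid f Q (b + t) N)
      - b * (μ.real Q * μ.real (avoid f Q 0 N))| ≤ b * γ := by
  rw [← nsmul_eq_mul b, ← nsmul_eq_mul b, ← Finset.card_range b, ← Finset.sum_const,
    Finset.card_range, ← Finset.sum_sub_distrib]
  refine (Finset.abs_sum_le_sum_abs _ _).trans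
    ((Finset.sum_le_card_nsmul _ _ γ fun i hi => ?_).trans_eq (by rw [Finset.card_range]))
  have hi := Finset.mem_range.1 hi
  have hshift : f^[i] ⁻¹' Q ∩ avoid f Q (b + t) N = f^[i] ⁻¹' (Q ∩ avoid f Q (b + t - i) N) := by
    rw [preimage_inter, preimage_iterate_avoid, Nat.sub_add_cancel (by omega)]
  rw [hshift, measureReal_preimage_iterate hf
    (hQ.inter (measurableSet_avoid hf.measurable hQ _ _))]
  exact hγ _ (by omega)

variable [IsFiniteMeasure μ]

theorem measureReal_inter_avoid_succ_add (hf : Measurable f) (hQ : MeasurableSet Q) (G : Set M)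
    (s a : ℕ) :
    μ.real (G ∩ avoid f Q s (a + 1)) + μ.real (G ∩ avoid f Q s a ∩ f^[s + a] ⁻¹' Q)
      = μ.real (G ∩ avoid f Q s a) := by
  rw [avoid_succ, ← inter_sdiff_assoc]
  exact measureReal_sdiff_add_inter (hf.iterate _ hQ)

theorem measureReal_sub_le_measureReal_inter_avoid (hf : MeasurePreserving f μ μ)
    (hQ : MeasurableSet Q) (G : Set M) (s ℓ : ℕ) :
    μ.real G - ℓ * μ.real Q ≤ μ.real (G ∩ avoid f Q s ℓ) := by
  induction ℓ with
  | zero => simp [avoid_zero]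
  | succ ℓ ih =>
    have hhit : μ.real (G ∩ avoid f Q s ℓ ∩ f^[s + ℓ] ⁻¹' Q) ≤ μ.real Q :=
      (measureReal_mono inter_subset_right).trans_eq (measureReal_preimage_iterate hf hQ _)
    have := measureReal_inter_avoid_succ_add (μ := μ) hf.measurable hQ G s ℓ
    push_cast
    linarith

theorem abs_measureReal_avoid_add_sub_le (hf : MeasurePreserving f μ μ) (hQ : MeasurableSet Q)
    (a n : ℕ) : |μ.real (avoid f Q 0 (a + n)) - μ.real (avoid f Q 0 a)| ≤ n * μ.real Q := by
  have h := measureReal_sub_le_measureReal_inter_avoid hf hQ (avoid f Q 0 a) (0 + a) n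
  rw [← avoid_add] at h
  rw [abs_sub_comm, abs_of_nonneg
    (sub_nonneg.2 (measureReal_mono (avoid_subset_avoid 0 (Nat.le_add_right a n))))]
  linarith

theorem measureReal_preimage_sdiff_avoid_le (hf : MeasurePreserving f μ μ)
    (hQ : MeasurableSet Q) (a : ℕ) :
    μ.real (f^[a] ⁻¹' Q \ avoid f Q 0 a) ≤
      ∑ j ∈ Finset.Ico 1 (a + 1), μ.real (Q ∩ f^[j] ⁻¹' Q) := by
  have hsub : f^[a] ⁻¹' Q \ avoid f Q 0 a ⊆
      ⋃ j ∈ Finset.Ico 1 (a + 1), f^[a - j] ⁻¹' (Q ∩ f^[j] ⁻¹' Q) := by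
    rintro x ⟨hx, hhit⟩
    simp only [avoid, mem_ofPred_eq, not_forall, not_not] at hhit
    obtain ⟨i, -, hi, hxi⟩ := hhit
    rw [zero_add] at hi
    refine mem_biUnion (x := a - i) (by simp; omega) ⟨?_, ?_⟩
    · rwa [Nat.sub_sub_self hi.le]
    · rwa [mem_preimage, ← Function.iterate_add_apply, Nat.sub_sub_self hi.le,
        Nat.sub_add_cancel hi.le]
  refine (measureReal_mono hsub (measure_ne_top _ _)).trans
    ((measureReal_biUnion_finset_le _ _).trans_eq ?_)
  exact Finset.sum_congr rfl fun j _ =>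
    measureReal_preimage_iterate hf (hQ.inter (hf.measurable.iterate j hQ)) _

theorem abs_measureReal_sub_inter_avoid_sub_sum_le (hf : MeasurePreserving f μ μ)
    (hQ : MeasurableSet Q) (G : Set M) (a : ℕ) :
    |μ.real G - μ.real (G ∩ avoid f Q 0 a) - ∑ i ∈ Finset.range a, μ.real (f^[i] ⁻¹' Q ∩ G)|
      ≤ a * ∑ j ∈ Finset.Ico 1 a, μ.real (Q ∩ f^[j] ⁻¹' Q) := by
  induction a with
  | zero => simp [avoid_zero]
  | succ a ih =>
    have hsucc := measureReal_inter_avoid_succ_add (μ := μ) hf.measurable hQ G 0 a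
    rw [zero_add] at hsucc
    have hle : μ.real (G ∩ avoid f Q 0 a ∩ f^[a] ⁻¹' Q) ≤ μ.real (f^[a] ⁻¹' Q ∩ G) :=
      measureReal_mono fun x hx => ⟨hx.2, hx.1.1⟩
    have hge : μ.real (f^[a] ⁻¹' Q ∩ G) ≤
        μ.real (G ∩ avoid f Q 0 a ∩ f^[a] ⁻¹' Q) + μ.real (f^[a] ⁻¹' Q \ avoid f Q 0 a) := by
      refine (measureReal_mono fun x hx => ?_).trans (measureReal_union_le _ _)
      exact (em (x ∈ avoid f Q 0 a)).imp (fun h => ⟨⟨hx.2, h⟩, hx.1⟩) fun h => ⟨hx.1, h⟩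
    have hrepeat := measureReal_preimage_sdiff_avoid_le hf hQ a
    have hmono : (a : ℝ) * ∑ j ∈ Finset.Ico 1 a, μ.real (Q ∩ f^[j] ⁻¹' Q) ≤
        a * ∑ j ∈ Finset.Ico 1 (a + 1), μ.real (Q ∩ f^[j] ⁻¹' Q) := by
      gcongr
      exact a.le_succ
    rw [Finset.sum_range_succ]
    push_cast
    rw [abs_le] at ih ⊢
    constructor <;> linarith [ih.1, ih.2]

-- A block of length `b` is followed by a gap of length `t`, over which the process decorrelates.
theorem abs_measureReal_avoid_block_sub_le (hf : MeasurePreserving f μ μ) (hQ : MeasurableSet Q)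
    {b t N : ℕ} {γ : ℝ}
    (hγ : ∀ s ≥ t, |μ.real (Q ∩ avoid f Q s N) - μ.real Q * μ.real (avoid f Q 0 N)| ≤ γ) :
    |μ.real (avoid f Q 0 (b + t + N)) - (1 - b * μ.real Q) * μ.real (avoid f Q 0 N)|
      ≤ b * γ + b * ∑ j ∈ Finset.Ico 1 b, μ.real (Q ∩ f^[j] ⁻¹' Q) + t * μ.real Q := by
  set G := avoid f Q (b + t) N
  have hsplit : avoid f Q 0 (b + t + N) = G ∩ avoid f Q 0 b ∩ avoid f Q b t := by
    rw [avoid_add, avoid_add, zero_add, zero_add, inter_comm, ← inter_assoc]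
  have hgap := measureReal_sub_le_measureReal_inter_avoid hf hQ (G ∩ avoid f Q 0 b) b t
  have hgap' : μ.real (G ∩ avoid f Q 0 b ∩ avoid f Q b t) ≤ μ.real (G ∩ avoid f Q 0 b) :=
    measureReal_mono inter_subset_left
  have hblock := abs_measureReal_sub_inter_avoid_sub_sum_le hf hQ G b
  have hdecorrelate := abs_sum_measureReal_preimage_inter_avoid_sub_le hf hQ (b := b) hγ
  rw [measureReal_avoid_eq_zero_start hf hQ] at hblock
  rw [hsplit]
  rw [abs_le] at hblock hdecorrelate ⊢
  constructor <;> linarith [hblock.1, hblock.2, hdecorrelate.1, hdecorrelate.2]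

end Avoid

section ExponentialLimit

theorem abs_exp_neg_sub_one_sub_le {x : ℝ} (hx : 0 ≤ x) : |Real.exp (-x) - (1 - x)| ≤ x ^ 2 := by
  have hlower := Real.one_sub_le_exp_neg x
  have hupper : Real.exp (-x) ≤ 1 - x + x ^ 2 := by
    rw [Real.exp_neg]
    refine inv_le_of_inv_le₀ (by nlinarith) (le_trans ?_ (Real.add_one_le_exp x))
    exact inv_le_of_inv_le₀ (by positivity)
      ((inv_le_iff_one_le_mul₀ (by positivity)).2 (by nlinarith [pow_nonneg hx 3]))
  rw [abs_le]
  constructor <;> nlinarith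

theorem abs_exp_neg_sub_exp_neg_le {x y : ℝ} (hx : 0 ≤ x) (hxy : x ≤ y) :
    |Real.exp (-x) - Real.exp (-y)| ≤ y - x := by
  rw [abs_of_nonneg (sub_nonneg.2 (Real.exp_le_exp.2 (neg_le_neg hxy)))]
  have hfactor : Real.exp (-y) = Real.exp (-x) * Real.exp (-(y - x)) := by
    rw [← Real.exp_add]; ring_nf
  nlinarith [Real.one_sub_le_exp_neg (y - x), Real.exp_pos (-x),
    Real.exp_le_one_iff.2 (neg_nonpos.2 hx)]

theorem abs_sub_exp_neg_le_of_step {w : ℕ → ℝ} {x ε : ℝ} {c : ℕ} (hx : 0 ≤ x) (hw0 : w 0 = 1)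
    (hw : ∀ N, |w N| ≤ 1) (hstep : ∀ N, |w (c + N) - (1 - x) * w N| ≤ ε) (K : ℕ) :
    |w (K * c) - Real.exp (-(K * x))| ≤ K * (ε + x ^ 2) := by
  induction K with
  | zero => simp [hw0]
  | succ K ih =>
    have hexp : Real.exp (-((K + 1 : ℕ) * x)) = Real.exp (-x) * Real.exp (-(K * x)) := by
      rw [← Real.exp_add]; push_cast; ring_nf
    rw [hexp, Nat.succ_mul, Nat.add_comm]
    calc |w (c + K * c) - Real.exp (-x) * Real.exp (-(K * x))|
      _ = |(w (c + K * c) - (1 - x) * w (K * c)) - (Real.exp (-x) - (1 - x)) * w (K * c)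
            + Real.exp (-x) * (w (K * c) - Real.exp (-(K * x)))| := by ring_nf
      _ ≤ |w (c + K * c) - (1 - x) * w (K * c)| + |Real.exp (-x) - (1 - x)| * |w (K * c)|
            + Real.exp (-x) * |w (K * c) - Real.exp (-(K * x))| := by
          refine (abs_add_le _ _).trans (add_le_add ((abs_sub _ _).trans_eq ?_) (le_of_eq ?_))
          · rw [abs_mul]
          · rw [abs_mul, Real.abs_exp]
      _ ≤ ε + x ^ 2 * 1 + 1 * (K * (ε + x ^ 2)) := by
          gcongr
          · exact hstep _
          · exact abs_exp_neg_sub_one_sub_le hx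
          · exact hw _
          · exact Real.exp_le_one_iff.2 (neg_nonpos.2 hx)
      _ = (K + 1 : ℕ) * (ε + x ^ 2) := by push_cast; ring

variable {M : Type*} [MeasurableSpace M] {f : M → M} {μ : Measure M} [IsProbabilityMeasure μ]

theorem abs_measureReal_avoid_sub_exp_le (hf : MeasurePreserving f μ μ) {Q : Set M}
    (hQ : MeasurableSet Q) {b t : ℕ} (hb : 0 < b) {γ : ℝ}
    (hγ : ∀ N, ∀ s ≥ t,
      |μ.real (Q ∩ avoid f Q s N) - μ.real Q * μ.real (avoid f Q 0 N)| ≤ γ) (N : ℕ) :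
    |μ.real (avoid f Q 0 N) - Real.exp (-(N * μ.real Q))| ≤
      N * γ + N * ∑ j ∈ Finset.Ico 1 b, μ.real (Q ∩ f^[j] ⁻¹' Q)
        + N * μ.real Q * (b * μ.real Q + 2 * (t / b)) + 2 * (b * μ.real Q) * (1 + t / b) := by
  set q := μ.real Q
  set S := ∑ j ∈ Finset.Ico 1 b, μ.real (Q ∩ f^[j] ⁻¹' Q)
  set K := N / (b + t)
  have hγ0 : 0 ≤ γ := (abs_nonneg _).trans (hγ 0 t le_rfl)
  have hb' : (0 : ℝ) < b := Nat.cast_pos.2 hb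
  have hdiv : K * (b + t) + N % (b + t) = N := Nat.div_add_mod' N (b + t)
  have hdiv' : (K : ℝ) * b + K * t + (N % (b + t) : ℕ) = N := by
    rw [← mul_add]; exact_mod_cast hdiv
  have hmod : ((N % (b + t) : ℕ) : ℝ) ≤ b * (1 + t / b) := by
    rw [mul_add, mul_one, mul_div_cancel₀ _ hb'.ne']
    exact_mod_cast (Nat.mod_lt N (by omega)).le
  have hKb : (K : ℝ) * b ≤ N := by
    linarith [(N % (b + t)).cast_nonneg (α := ℝ), mul_nonneg K.cast_nonneg (t.cast_nonneg (α := ℝ))]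
  have hKt : (K : ℝ) * t ≤ N * (t / b) := by
    calc (K : ℝ) * t = K * b * (t / b) := by field_simp
      _ ≤ N * (t / b) := by gcongr
  have hremainder : |μ.real (avoid f Q 0 N) - μ.real (avoid f Q 0 (K * (b + t)))| ≤
      b * (1 + t / b) * q := by
    have h := abs_measureReal_avoid_add_sub_le hf hQ (K * (b + t)) (N % (b + t))
    rw [hdiv] at h
    exact h.trans (by gcongr)
  have hblocks : |μ.real (avoid f Q 0 (K * (b + t))) - Real.exp (-(K * (b * q)))| ≤
      K * (b * γ + b * S + t * q + (b * q) ^ 2) :=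
    abs_sub_exp_neg_le_of_step (w := fun N => μ.real (avoid f Q 0 N)) (by positivity)
      (by simp [avoid_zero]) (fun N => by
        rw [abs_of_nonneg measureReal_nonneg]; exact measureReal_le_one)
      (fun N => abs_measureReal_avoid_block_sub_le hf hQ (hγ N)) K
  have hexp : |Real.exp (-(K * (b * q))) - Real.exp (-(N * q))| ≤ N * q - K * (b * q) :=
    abs_exp_neg_sub_exp_neg_le (by positivity) (by rw [← mul_assoc]; gcongr)
  calc |μ.real (avoid f Q 0 N) - Real.exp (-(N * q))|
    _ ≤ b * (1 + t / b) * q + K * (b * γ + b * S + t * q + (b * q) ^ 2)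
          + (N * q - K * (b * q)) :=
        (abs_sub_le _ _ _).trans (add_le_add ((abs_sub_le _ _ _).trans
          (add_le_add hremainder hblocks)) hexp)
    _ = b * (1 + t / b) * q + (K * b * (γ + S + b * q * q) + K * t * q + K * t * q
          + (N % (b + t) : ℕ) * q) := by
        rw [← hdiv']; ring
    _ ≤ b * (1 + t / b) * q + (N * (γ + S + b * q * q) + N * (t / b) * q + N * (t / b) * q
          + b * (1 + t / b) * q) := by gcongr
    _ = _ := by ring

theorem tendsto_measureReal_avoid (hf : MeasurePreserving f μ μ) {ι : Type*} {l : Filter ι}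
    {Q : ι → Set M} (hQ : ∀ᶠ i in l, MeasurableSet (Q i)) {N b t : ι → ℕ} (hb : ∀ i, 0 < b i)
    {γ : ι → ℝ}
    (hγ : ∀ i N, ∀ s ≥ t i, |μ.real (Q i ∩ avoid f (Q i) s N)
      - μ.real (Q i) * μ.real (avoid f (Q i) 0 N)| ≤ γ i)
    (hNγ : Tendsto (fun i => N i * γ i) l (𝓝 0))
    (hNS : Tendsto (fun i => N i * ∑ j ∈ Finset.Ico 1 (b i), μ.real (Q i ∩ f^[j] ⁻¹' Q i)) l (𝓝 0))
    {L : ℝ} (hNQ : Tendsto (fun i => N i * μ.real (Q i)) l (𝓝 L))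
    (hbQ : Tendsto (fun i => b i * μ.real (Q i)) l (𝓝 0))
    (htb : Tendsto (fun i => (t i : ℝ) / b i) l (𝓝 0)) :
    Tendsto (fun i => μ.real (avoid f (Q i) 0 (N i))) l (𝓝 (Real.exp (-L))) := by
  have herror := ((hNγ.add hNS).add (hNQ.mul (hbQ.add (htb.const_mul 2)))).add
    ((hbQ.const_mul 2).mul (htb.const_add 1))
  simp only [mul_zero, add_zero, zero_mul] at herror
  have hexp : Tendsto (fun i => Real.exp (-(N i * μ.real (Q i)))) l (𝓝 (Real.exp (-L))) :=
    (Real.continuous_exp.tendsto _).comp hNQ.neg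
  have hclose : Tendsto (fun i => μ.real (avoid f (Q i) 0 (N i))
      - Real.exp (-(N i * μ.real (Q i)))) l (𝓝 0) := squeeze_zero_norm'
    (hQ.mono fun i hQi => abs_measureReal_avoid_sub_exp_le hf hQi (hb i) (hγ i) (N i)) herror
  simpa only [sub_add_cancel, zero_add] using hclose.add hexp

end ExponentialLimit

section SurvivalLaw

variable {M : Type*} {f : M → M} {U V : Set M}

theorem avoid_anti (h : U ⊆ V) (s ℓ : ℕ) : avoid f V s ℓ ⊆ avoid f U s ℓ :=
  fun _ hx i hsi his hi => hx i hsi his (h hi)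

theorem avoid_inter_avoid_sdiff_subset (s ℓ : ℕ) :
    avoid f U s ℓ ∩ avoid f (V \ U) s ℓ ⊆ avoid f V s ℓ :=
  fun _ hx i hsi his hi => hx.2 i hsi his ⟨hi, hx.1 i hsi his⟩

-- The last visit to `U` before time `N + p` is either an escape or falls in the last `p` times.
theorem avoid_sdiff_preimage_inter_subset {p : ℕ} (hp : 0 < p) (N : ℕ) :
    avoid f (U \ f^[p] ⁻¹' U) 0 N ∩ avoid f U N p ⊆ avoid f U 0 N := by
  rintro x ⟨hescape, hend⟩
  suffices h : ∀ k i, i < N + p → N + p - i ≤ k → f^[i] x ∉ U from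
    fun i _ hi => h _ i (by omega) le_rfl
  intro k
  induction k with
  | zero => omega
  | succ k ih =>
    intro i hi hk hiU
    rcases le_or_gt N i with hNi | hiN
    · exact hend i hNi hi hiU
    · refine hescape i i.zero_le (by omega) ⟨hiU, ?_⟩
      rw [mem_preimage, ← Function.iterate_add_apply, add_comm]
      exact ih (i + p) (by omega) (by omega)

variable [MeasurableSpace M] {μ : Measure M}

section Comparison

variable [IsFiniteMeasure μ]

theorem abs_measureReal_avoid_sub_le_of_subset (hf : MeasurePreserving f μ μ)
    (hU : MeasurableSet U) (hV : MeasurableSet V) (h : U ⊆ V) (N : ℕ) :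
    |μ.real (avoid f U 0 N) - μ.real (avoid f V 0 N)| ≤ N * |μ.real U - μ.real V| := by
  have hanti : μ.real (avoid f V 0 N) ≤ μ.real (avoid f U 0 N) :=
    measureReal_mono (avoid_anti h 0 N)
  have hdiff := (measureReal_sub_le_measureReal_inter_avoid hf (hV.diff hU) _ 0 N).trans
    (measureReal_mono (avoid_inter_avoid_sdiff_subset 0 N))
  rw [measureReal_sdiff h hU] at hdiff
  rw [abs_of_nonneg (sub_nonneg.2 hanti), abs_sub_comm,
    abs_of_nonneg (sub_nonneg.2 (measureReal_mono h))]
  linarith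

theorem measureReal_avoid_sdiff_preimage_sub_le (hf : MeasurePreserving f μ μ)
    (hU : MeasurableSet U) {p : ℕ} (hp : 0 < p) (N : ℕ) :
    μ.real (avoid f (U \ f^[p] ⁻¹' U) 0 N) - p * μ.real U ≤ μ.real (avoid f U 0 N) :=
  (measureReal_sub_le_measureReal_inter_avoid hf hU _ N p).trans
    (measureReal_mono (avoid_sdiff_preimage_inter_subset hp N))

end Comparison

variable {ι : Type*} {l : Filter ι} {A B : ι → Set M} {F : ℝ → ℝ}

/-- The hitting times of the sets `B i`, rescaled by `μ (B i)`, have asymptotically the survival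
function `F`. Integer times `N i` are used, so that no rounding enters the definition. -/
def HasSurvivalLaw (μ : Measure M) (f : M → M) (B : ι → Set M) (l : Filter ι) (F : ℝ → ℝ) :
    Prop :=
  ∀ (s : ℝ) (N : ι → ℕ), Tendsto (fun i => N i * μ.real (B i)) l (𝓝 s) →
    Tendsto (fun i => μ.real (avoid f (B i) 0 (N i))) l (𝓝 (F s))

theorem HasSurvivalLaw.of_tendsto_div_one [IsFiniteMeasure μ] (hA : HasSurvivalLaw μ f A l F)
    (hf : MeasurePreserving f μ μ) (hAm : ∀ᶠ i in l, MeasurableSet (A i))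
    (hBm : ∀ᶠ i in l, MeasurableSet (B i)) (hnested : ∀ᶠ i in l, A i ⊆ B i ∨ B i ⊆ A i)
    (hratio : Tendsto (fun i => μ.real (A i) / μ.real (B i)) l (𝓝 1)) :
    HasSurvivalLaw μ f B l F := by
  intro s N hN
  have hB0 : ∀ᶠ i in l, μ.real (B i) ≠ 0 :=
    (hratio.eventually_ne one_ne_zero).mono fun i hi h => hi (by rw [h, div_zero])
  have hNA : Tendsto (fun i => N i * μ.real (A i)) l (𝓝 s) := by
    refine (mul_one s ▸ hN.mul hratio).congr' (hB0.mono fun i hi => ?_)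
    rw [mul_assoc, mul_div_cancel₀ _ hi]
  have herror : Tendsto (fun i => N i * |μ.real (A i) - μ.real (B i)|) l (𝓝 0) := by
    have h := hN.mul (hratio.sub_const 1).abs
    rw [sub_self, abs_zero, mul_zero] at h
    refine h.congr' (hB0.mono fun i hi => ?_)
    rw [mul_assoc, ← abs_of_nonneg (measureReal_nonneg (μ := μ) (s := B i)), ← abs_mul, mul_sub,
      abs_of_nonneg measureReal_nonneg, mul_div_cancel₀ _ hi, mul_one]
  have hclose : Tendsto (fun i => μ.real (avoid f (B i) 0 (N i)) - μ.real (avoid f (A i) 0 (N i)))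
      l (𝓝 0) := by
    refine squeeze_zero_norm' ?_ herror
    filter_upwards [hAm, hBm, hnested] with i hAi hBi hi
    rw [Real.norm_eq_abs]
    rcases hi with h | h
    · rw [abs_sub_comm]
      exact abs_measureReal_avoid_sub_le_of_subset hf hAi hBi h _
    · rw [abs_sub_comm (μ.real (A i))]
      exact abs_measureReal_avoid_sub_le_of_subset hf hBi hAi h _
  simpa only [sub_add_cancel, zero_add] using hclose.add (hA s N hNA)

end SurvivalLaw

section HittingTime

variable {M : Type*} [MeasurableSpace M] {μ : Measure M} {f : M → M} {A : Set M}

theorem natCast_lt_ofReal_div_measure_iff (hA : 0 < μ.real A) {s : ℝ} {j : ℕ} :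
    (j : ℝ≥0∞) < ENNReal.ofReal s / μ A ↔ j < ⌈s / μ.real A⌉₊ := by
  obtain ⟨hA0, hAtop⟩ := ENNReal.toReal_pos_iff.1 hA
  rw [Nat.lt_ceil, lt_div_iff₀ hA, ENNReal.lt_div_iff_mul_lt (.inl hA0.ne') (.inl hAtop.ne),
    ← ENNReal.ofReal_toReal hAtop.ne, ← ENNReal.ofReal_natCast, ← ENNReal.ofReal_mul j.cast_nonneg]
  exact ENNReal.ofReal_lt_ofReal_iff_of_nonneg (by positivity)

theorem mem_hitBefore_iff {s : ℝ} {x : M} :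
    x ∈ hitBefore μ f A s ↔
      ∃ j : ℕ, (1 ≤ j ∧ f^[j] x ∈ A) ∧ (j : ℝ≥0∞) < ENNReal.ofReal s / μ A := by
  simp only [hitBefore, hittingTime, mem_ofPred_eq, ENat.toENNReal_iInf, iInf_lt_iff,
    ENat.toENNReal_coe, exists_prop]

theorem hitBefore_eq_compl_avoid (hA : 0 < μ.real A) (s : ℝ) :
    hitBefore μ f A s = (avoid f A 1 (⌈s / μ.real A⌉₊ - 1))ᶜ := by
  ext x
  simp only [mem_hitBefore_iff, natCast_lt_ofReal_div_measure_iff hA, avoid, mem_compl_iff,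
    mem_ofPred_eq, not_forall, not_not, exists_prop]
  refine exists_congr fun j =>
    ⟨fun h => ⟨h.1.1, by omega, h.1.2⟩, fun h => ⟨⟨h.1, h.2.2⟩, by omega⟩⟩

end HittingTime

section Rescaling

variable {ι : Type*} {l : Filter ι} {y : ι → ℝ}

theorem tendsto_natFloor_div_mul (hy : Tendsto y l (𝓝[>] 0)) {s : ℝ} (hs : 0 ≤ s) :
    Tendsto (fun i => (⌊s / y i⌋₊ : ℝ) * y i) l (𝓝 s) :=
  ((tendsto_nat_floor_mul_div_atTop hs).comp hy.inv_tendsto_nhdsGT_zero).congr fun i => by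
    simp [div_eq_mul_inv]

theorem tendsto_natCeil_div_sub_one_mul (hy : Tendsto y l (𝓝[>] 0)) {s : ℝ} (hs : 0 ≤ s) :
    Tendsto (fun i => ((⌈s / y i⌉₊ - 1 : ℕ) : ℝ) * y i) l (𝓝 s) := by
  have hceil : Tendsto (fun i => (⌈s / y i⌉₊ : ℝ) * y i) l (𝓝 s) :=
    ((tendsto_nat_ceil_mul_div_atTop hs).comp hy.inv_tendsto_nhdsGT_zero).congr fun i => by
      simp [div_eq_mul_inv]
  obtain ⟨hy0, hypos⟩ := tendsto_nhdsWithin_iff.1 hy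
  refine tendsto_of_tendsto_of_tendsto_of_le_of_le' (by simpa using hceil.sub hy0) hceil
    (hypos.mono fun i hi => ?_) (hypos.mono fun i hi => ?_)
  · rw [← sub_one_mul]
    exact mul_le_mul_of_nonneg_right (sub_le_iff_le_add.2 (mod_cast le_tsub_add)) hi.le
  · exact mul_le_mul_of_nonneg_right (Nat.cast_le.2 (Nat.sub_le _ _)) hi.le

end Rescaling

section Escape

variable {M : Type*} (f : M → M) (X : M → EReal) (p : ℕ) (u : ℝ)

theorem escape_zero : escape f X p u 0 = exceed f X u 0 \ f^[p] ⁻¹' exceed f X u 0 := by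
  ext x
  simp [escape, exceed]

theorem escape_eq_preimage_iterate (i : ℕ) : escape f X p u i = f^[i] ⁻¹' escape f X p u 0 := by
  ext x
  simp only [escape, mem_ofPred_eq, mem_preimage, zero_add, ← Function.iterate_add_apply,
    Function.iterate_zero_apply, add_comm p i]

theorem noEscape_eq_avoid (s ℓ : ℕ) :
    noEscape f X p u s ℓ = avoid f (escape f X p u 0) s ℓ := by
  ext x
  refine forall₃_congr fun i _ _ => ?_
  rw [escape_eq_preimage_iterate, mem_preimage]

end Escape

section BlockLength

variable {k t : ℕ → ℕ}

theorem tendsto_blockLength_div (hk : Tendsto k atTop atTop) :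
    Tendsto (fun n : ℕ => ((n / k n + 1 : ℕ) : ℝ) / n) atTop (𝓝 0) := by
  have hinv : Tendsto (fun n => (k n : ℝ)⁻¹ + (n : ℝ)⁻¹) atTop (𝓝 0) := by
    simpa using ((tendsto_inv_atTop_nhds_zero_nat (𝕜 := ℝ)).comp hk).add
      (tendsto_inv_atTop_nhds_zero_nat (𝕜 := ℝ))
  refine squeeze_zero' (.of_forall fun n => by positivity) ?_ hinv
  filter_upwards [eventually_gt_atTop 0] with n hn
  have hn' : (0 : ℝ) < n := Nat.cast_pos.2 hn
  rw [div_le_iff₀ hn', add_mul, inv_mul_cancel₀ hn'.ne', inv_mul_eq_div]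
  push_cast
  gcongr
  exact Nat.cast_div_le

theorem tendsto_gap_div_blockLength (hk : Tendsto k atTop atTop)
    (hkt : (fun n => (k n : ℝ) * (t n : ℝ)) =o[atTop] (fun n : ℕ => (n : ℝ))) :
    Tendsto (fun n : ℕ => (t n : ℝ) / ((n / k n + 1 : ℕ) : ℝ)) atTop (𝓝 0) := by
  refine squeeze_zero' (.of_forall fun n => by positivity) ?_ hkt.tendsto_div_nhds_zero
  filter_upwards [eventually_gt_atTop 0, hk.eventually_gt_atTop 0] with n hn hkn
  have hn' : (0 : ℝ) < n := Nat.cast_pos.2 hn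
  have hblock : (n : ℝ) ≤ k n * (n / k n + 1 : ℕ) := by
    exact_mod_cast (Nat.lt_mul_div_succ n hkn).le
  rw [div_le_div_iff₀ (by positivity) hn', mul_right_comm, mul_comm (t n : ℝ)]
  gcongr

end BlockLength

section ExceedanceLaw

variable {ι : Type*} {l : Filter ι}

theorem tendsto_mul_of_tendsto_div {N n : ι → ℕ} (hn : Tendsto n l atTop) {a b : ℝ} {x : ι → ℝ}
    (hN : Tendsto (fun i => (N i : ℝ) / n i) l (𝓝 a))
    (hx : Tendsto (fun i => n i * x i) l (𝓝 b)) :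
    Tendsto (fun i => N i * x i) l (𝓝 (a * b)) := by
  refine (hN.mul hx).congr' ((hn.eventually_ne_atTop 0).mono fun i hi => ?_)
  rw [← mul_assoc, div_mul_cancel₀ _ (Nat.cast_ne_zero.2 hi)]

variable {M : Type*} [MeasurableSpace M] {μ : Measure M} {f : M → M} {X : M → EReal} {p : ℕ}
  {u : ℕ → ℝ} {t : ℕ → ℕ} {n : ι → ℕ}

theorem CondD.tendsto_measureReal_avoid_escape [IsProbabilityMeasure μ] (hD : CondD μ f X p u t)
    (hD' : CondDPrime μ f X p u t) (hf : MeasurePreserving f μ μ)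
    (hmeas : ∀ᶠ n in atTop, MeasurableSet (escape f X p (u n) 0)) {q : ℝ}
    (hq : Tendsto (fun n : ℕ => (n : ℝ) * μ.real (escape f X p (u n) 0)) atTop (𝓝 q))
    (hn : Tendsto n l atTop) {N : ι → ℕ} {a : ℝ}
    (hN : Tendsto (fun i => (N i : ℝ) / n i) l (𝓝 a)) :
    Tendsto (fun i => μ.real (avoid f (escape f X p (u (n i)) 0) 0 (N i))) l
      (𝓝 (Real.exp (-(a * q)))) := by
  obtain ⟨-, γ, hγanti, hγ0, hγ⟩ := hD
  obtain ⟨k, hk, hkt, hS⟩ := hD'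
  refine tendsto_measureReal_avoid hf (b := fun i => n i / k (n i) + 1) (t := fun i => t (n i))
    (γ := fun i => γ (n i) (t (n i))) (hn.eventually hmeas) (fun _ => Nat.succ_pos _)
    (fun i ℓ s hs => ?_) ?_ ?_ (tendsto_mul_of_tendsto_div hn hN (hq.comp hn)) ?_
    ((tendsto_gap_div_blockLength hk hkt).comp hn)
  · simp only [← noEscape_eq_avoid]
    exact (hγ ℓ s (n i)).trans (hγanti _ hs)
  · simpa only [mul_zero] using tendsto_mul_of_tendsto_div hn hN (hγ0.comp hn)
  · simp only [← escape_eq_preimage_iterate]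
    simpa only [mul_zero, Finset.Ico_add_one_right_eq_Icc] using
      tendsto_mul_of_tendsto_div hn hN (hS.comp hn)
  · simpa only [zero_mul] using
      tendsto_mul_of_tendsto_div hn ((tendsto_blockLength_div hk).comp hn) (hq.comp hn)

theorem tendsto_measureReal_avoid_of_sdiff_preimage [IsFiniteMeasure μ]
    (hf : MeasurePreserving f μ μ) {U : ι → Set M} (hU : ∀ᶠ i in l, MeasurableSet (U i))
    (hU0 : Tendsto (fun i => μ.real (U i)) l (𝓝 0)) (hp : 0 < p) {N : ι → ℕ} {a : ℝ}
    (h : Tendsto (fun i => μ.real (avoid f (U i \ f^[p] ⁻¹' U i) 0 (N i))) l (𝓝 a)) :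
    Tendsto (fun i => μ.real (avoid f (U i) 0 (N i))) l (𝓝 a) :=
  tendsto_of_tendsto_of_tendsto_of_le_of_le' (by simpa using h.sub (hU0.const_mul (p : ℝ))) h
    (hU.mono fun i hi => measureReal_avoid_sdiff_preimage_sub_le hf hi hp (N i))
    (.of_forall fun i => measureReal_mono (avoid_anti sdiff_subset 0 (N i)))

theorem tendsto_zero_of_tendsto_natCast_mul {x : ℕ → ℝ} {τ : ℝ}
    (hx : Tendsto (fun n : ℕ => n * x n) atTop (𝓝 τ)) : Tendsto x atTop (𝓝 0) := by
  refine (zero_mul τ ▸ tendsto_inv_atTop_nhds_zero_nat.mul hx).congr' ?_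
  filter_upwards [eventually_ne_atTop 0] with n hn
  exact inv_mul_cancel_left₀ (Nat.cast_ne_zero.2 hn) _

theorem CondD.hasSurvivalLaw_exceed [IsProbabilityMeasure μ] (hD : CondD μ f X p u t)
    (hD' : CondDPrime μ f X p u t) (hf : MeasurePreserving f μ μ)
    (hmeas : ∀ᶠ n in atTop, MeasurableSet (exceed f X (u n) 0)) (hp : 0 < p) {τ : ℝ} (hτ : τ ≠ 0)
    (hu : Tendsto (fun n : ℕ => (n : ℝ) * μ.real (exceed f X (u n) 0)) atTop (𝓝 τ)) {θ : ℝ}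
    (hθ : Tendsto (fun n : ℕ => (n : ℝ) * μ.real (escape f X p (u n) 0)) atTop (𝓝 (θ * τ)))
    (hn : Tendsto n l atTop) :
    HasSurvivalLaw μ f (fun i => exceed f X (u (n i)) 0) l fun s => Real.exp (-θ * s) := by
  intro s N hN
  have hNn : Tendsto (fun i => (N i : ℝ) / n i) l (𝓝 (s / τ)) := by
    have hun := hu.comp hn
    refine (hN.div hun hτ).congr' ((hun.eventually_ne hτ).mono fun i hi => ?_)
    exact mul_div_mul_right _ _ (right_ne_zero_of_mul hi)
  have hescape_meas : ∀ᶠ n in atTop, MeasurableSet (escape f X p (u n) 0) :=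
    hmeas.mono fun n hn => by rw [escape_zero]; exact hn.diff (hf.measurable.iterate p hn)
  have hescape := hD.tendsto_measureReal_avoid_escape hD' hf hescape_meas hθ hn hNn
  have hexponent : -(s / τ * (θ * τ)) = -θ * s := by field_simp
  simp only [escape_zero, hexponent] at hescape
  exact tendsto_measureReal_avoid_of_sdiff_preimage hf (hn.eventually hmeas)
    ((tendsto_zero_of_tendsto_natCast_mul hu).comp hn) hp hescape

end ExceedanceLaw

section ConvexSequence

variable {w : ℕ → ℝ} {K N : ℕ}

theorem mul_decrement_le_sub (hw : Antitone fun k => w k - w (k + 1)) (k h : ℕ) :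
    h * (w (k + h) - w (k + h + 1)) ≤ w k - w (k + h) := by
  induction h with
  | zero => simp
  | succ h ih =>
    have hdec : w (k + (h + 1)) - w (k + (h + 1) + 1) ≤ w (k + h) - w (k + h + 1) :=
      hw (Nat.le_succ _)
    have hmul := mul_le_mul_of_nonneg_left hdec h.cast_nonneg
    rw [← add_assoc] at hdec hmul ⊢
    push_cast
    linarith

theorem sub_le_mul_decrement (hw : Antitone fun k => w k - w (k + 1)) (k h : ℕ) :
    w k - w (k + h) ≤ h * (w k - w (k + 1)) := by
  induction h with
  | zero => simp
  | succ h ih =>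
    have hdec : w (k + h) - w (k + h + 1) ≤ w k - w (k + 1) := hw (Nat.le_add_right k h)
    rw [← add_assoc]
    push_cast
    linarith

theorem decrement_le_secant (hw : Antitone fun k => w k - w (k + 1)) (h : K < N) :
    w N - w (N + 1) ≤ (w K - w N) / (N - K) := by
  rw [le_div_iff₀' (sub_pos.2 (Nat.cast_lt.2 h)), ← Nat.cast_sub h.le]
  simpa only [Nat.add_sub_cancel' h.le] using mul_decrement_le_sub hw K (N - K)

theorem secant_le_decrement (hw : Antitone fun k => w k - w (k + 1)) (h : N < K) :
    (w K - w N) / (N - K) ≤ w N - w (N + 1) := by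
  rw [← neg_div_neg_eq, neg_sub, neg_sub, div_le_iff₀' (sub_pos.2 (Nat.cast_lt.2 h)),
    ← Nat.cast_sub h.le]
  simpa only [Nat.add_sub_cancel' h.le] using sub_le_mul_decrement hw N (K - N)

variable {ι : Type*} {l : Filter ι} {W : ι → ℕ → ℝ} {y : ι → ℝ} {F : ℝ → ℝ} {s : ℝ}

theorem tendsto_secant {N K : ι → ℕ} (hW : ∀ (s : ℝ) (N : ι → ℕ),
      Tendsto (fun i => N i * y i) l (𝓝 s) → Tendsto (fun i => W i (N i)) l (𝓝 (F s)))
    (hN : Tendsto (fun i => N i * y i) l (𝓝 s)) {r : ℝ}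
    (hK : Tendsto (fun i => K i * y i) l (𝓝 r)) (hrs : r ≠ s) :
    Tendsto (fun i => (W i (K i) - W i (N i)) / (N i - K i) / y i) l (𝓝 (-slope F s r)) := by
  have hlim := ((hW r K hK).sub (hW s N hN)).div (hN.sub hK) (sub_ne_zero.2 hrs.symm)
  rw [slope_def_field, ← div_neg, neg_sub]
  refine hlim.congr fun i => ?_
  rw [Pi.div_apply, div_div, sub_mul]

theorem tendsto_decrement_div (hconv : ∀ i, Antitone fun k => W i k - W i (k + 1))
    (hW : ∀ (s : ℝ) (N : ι → ℕ),
      Tendsto (fun i => N i * y i) l (𝓝 s) → Tendsto (fun i => W i (N i)) l (𝓝 (F s)))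
    (hy : Tendsto y l (𝓝[>] 0)) (hs : 0 < s) {F' : ℝ} (hF : HasDerivAt F F' s)
    {N : ι → ℕ} (hN : Tendsto (fun i => N i * y i) l (𝓝 s)) :
    Tendsto (fun i => (W i (N i) - W i (N i + 1)) / y i) l (𝓝 (-F')) := by
  have hypos : ∀ᶠ i in l, 0 < y i := (tendsto_nhdsWithin_iff.1 hy).2
  have hslope := (hasDerivAt_iff_tendsto_slope.1 hF).neg
  have hfloor {r : ℝ} (hr : 0 < r) := tendsto_natFloor_div_mul hy hr.le
  refine tendsto_order.2 ⟨fun α hα => ?_, fun α hα => ?_⟩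
  · obtain ⟨r, hαr, hsr : s < r⟩ := (((hslope.mono_left (nhdsGT_le_nhdsNE s)).eventually_const_lt
      hα).and self_mem_nhdsWithin).exists
    have hK := hfloor (hs.trans hsr)
    filter_upwards [hypos, hN.eventually_lt hK hsr,
      (tendsto_secant hW hN hK hsr.ne').eventually_const_lt hαr] with i hi hNK hlt
    refine hlt.trans_le (div_le_div_of_nonneg_right (secant_le_decrement (hconv i) ?_) hi.le)
    exact Nat.cast_lt.1 (lt_of_mul_lt_mul_right hNK hi.le)
  · obtain ⟨r, hαr, hr : 0 < r, hrs : r < s⟩ := (((hslope.mono_left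
      (nhdsLT_le_nhdsNE s)).eventually_lt_const hα).and (Ioo_mem_nhdsLT hs)).exists
    have hK := hfloor hr
    filter_upwards [hypos, hK.eventually_lt hN hrs,
      (tendsto_secant hW hN hK hrs.ne).eventually_lt_const hαr] with i hi hKN hlt
    refine (div_le_div_of_nonneg_right (decrement_le_secant (hconv i) ?_) hi.le).trans_lt hlt
    exact Nat.cast_lt.1 (lt_of_mul_lt_mul_right hKN hi.le)

end ConvexSequence

section HittingAndReturnTimes

variable {M : Type*} [MeasurableSpace M] {μ : Measure M} {f : M → M}

theorem measureReal_inter_avoid_one_eq_sub [IsFiniteMeasure μ] (hf : MeasurePreserving f μ μ)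
    {A : Set M} (hA : MeasurableSet A) (k : ℕ) :
    μ.real (A ∩ avoid f A 1 k) = μ.real (avoid f A 0 k) - μ.real (avoid f A 0 (k + 1)) := by
  have hsplit : avoid f A 0 (k + 1) = avoid f A 1 k \ A := by
    rw [add_comm k 1, avoid_add, avoid_one, zero_add, inter_comm, sdiff_eq,
      Function.iterate_zero, preimage_id]
  have hadd := measureReal_sdiff_add_inter (μ := μ) (s := avoid f A 1 k) hA
  rw [hsplit, ← measureReal_avoid_eq_zero_start hf hA 1, inter_comm]
  linarith

theorem antitone_measureReal_avoid_sub [IsFiniteMeasure μ] (hf : MeasurePreserving f μ μ)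
    {A : Set M} (hA : MeasurableSet A) :
    Antitone fun k => μ.real (avoid f A 0 k) - μ.real (avoid f A 0 (k + 1)) := by
  intro a b hab
  simp only [← measureReal_inter_avoid_one_eq_sub hf hA]
  exact measureReal_mono (inter_subset_inter_right _ (avoid_subset_avoid 1 hab))

theorem cond_real_hitBefore [IsFiniteMeasure μ] (hf : MeasurePreserving f μ μ) {A : Set M}
    (hA : MeasurableSet A) (hA0 : 0 < μ.real A) (s : ℝ) :
    (ProbabilityTheory.cond μ A).real (hitBefore μ f A s) =
      1 - (μ.real (avoid f A 0 (⌈s / μ.real A⌉₊ - 1))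
        - μ.real (avoid f A 0 (⌈s / μ.real A⌉₊ - 1 + 1))) / μ.real A := by
  have hadd := measureReal_sdiff_add_inter (μ := μ) (s := A)
    (measurableSet_avoid hf.measurable hA 1 (⌈s / μ.real A⌉₊ - 1))
  rw [measureReal_def, ProbabilityTheory.cond_apply hA, ENNReal.toReal_mul, ENNReal.toReal_inv,
    ← measureReal_def, ← measureReal_def, hitBefore_eq_compl_avoid hA0, ← sdiff_eq,
    ← measureReal_inter_avoid_one_eq_sub hf hA, eq_sub_iff_add_eq, inv_mul_eq_div, ← add_div, hadd,
    div_self hA0.ne']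

variable {ι : Type*} {l : Filter ι} {B : ι → Set M} {F : ℝ → ℝ} {s : ℝ}

theorem HasSurvivalLaw.tendsto_hitBefore [IsProbabilityMeasure μ] (h : HasSurvivalLaw μ f B l F)
    (hf : MeasurePreserving f μ μ) (hB : ∀ i, MeasurableSet (B i))
    (hB0 : Tendsto (fun i => μ.real (B i)) l (𝓝[>] 0)) (hs : 0 ≤ s) :
    Tendsto (fun i => μ.real (hitBefore μ f (B i) s)) l (𝓝 (1 - F s)) := by
  refine ((h s _ (tendsto_natCeil_div_sub_one_mul hB0 hs)).const_sub 1).congr' ?_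
  filter_upwards [(tendsto_nhdsWithin_iff.1 hB0).2] with i hi
  rw [hitBefore_eq_compl_avoid hi, probReal_compl_eq_one_sub
    (measurableSet_avoid hf.measurable (hB i) _ _), measureReal_avoid_eq_zero_start hf (hB i) 1]

theorem HasSurvivalLaw.tendsto_cond_hitBefore [IsFiniteMeasure μ] (h : HasSurvivalLaw μ f B l F)
    (hf : MeasurePreserving f μ μ) (hB : ∀ i, MeasurableSet (B i))
    (hB0 : Tendsto (fun i => μ.real (B i)) l (𝓝[>] 0)) (hs : 0 < s) {F' : ℝ}
    (hF : HasDerivAt F F' s) :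
    Tendsto (fun i => (ProbabilityTheory.cond μ (B i)).real (hitBefore μ f (B i) s)) l
      (𝓝 (1 + F')) := by
  have hdec := tendsto_decrement_div (fun i => antitone_measureReal_avoid_sub hf (hB i)) h hB0 hs
    hF (tendsto_natCeil_div_sub_one_mul hB0 hs.le)
  rw [← sub_neg_eq_add]
  refine (hdec.const_sub 1).congr' ?_
  filter_upwards [(tendsto_nhdsWithin_iff.1 hB0).2] with i hi
  rw [cond_real_hitBefore hf (hB i) hi]

end HittingAndReturnTimes

section PeakFunction

variable {g : ℝ≥0 → EReal}

theorem IsPeakFunction.le_apply_zero (hg : IsPeakFunction g) (y : ℝ≥0) : g y ≤ g 0 := by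
  obtain ⟨v, -, w, hw, -, hbij, hout⟩ := hg
  exact (lt_or_ge y v).elim (fun hy => (hbij.mapsTo hy).2) fun hy => (hout y hy).trans hw.le

theorem IsPeakFunction.exists_setOf_lt_eq_Iio (hg : IsPeakFunction g) :
    ∃ v > 0, ∀ u < g 0, (∃ y < v, g y ≤ u) → ∃ z > 0, {y | u < g y} = Iio z := by
  obtain ⟨v, hv, w, -, hanti, hbij, hout⟩ := hg
  refine ⟨v, hv, fun u hu ⟨y, hy, hyu⟩ => ?_⟩
  have hwu : w < u := (hbij.mapsTo hy).1.trans_le hyu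
  obtain ⟨z, hz, rfl⟩ := hbij.surjOn ⟨hwu, hu.le⟩
  refine ⟨z, pos_iff_ne_zero.2 (by rintro rfl; exact hu.false), ?_⟩
  ext a
  rcases lt_or_ge a v with ha | ha
  · exact hanti.lt_iff_gt hz ha
  · exact iff_of_false ((hout a ha).trans hwu.le).not_gt (hz.le.trans ha).not_gt

end PeakFunction

section ExceedanceBalls

open Metric

variable {M : Type*} [MetricSpace M] [MeasurableSpace M] {μ : Measure M} {ζ : M}

theorem ContinuousBallMeasure.tendsto (h : ContinuousBallMeasure μ ζ) :
    Tendsto (fun r => μ.real (ball ζ r)) (𝓝[>] 0) (𝓝 0) := by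
  obtain ⟨η, hη, hcont⟩ := h
  have hzero : ContinuousWithinAt (fun r => μ.real (ball ζ r)) (Ico 0 η) 0 := hcont 0 ⟨le_rfl, hη⟩
  rw [ContinuousWithinAt, ball_zero, measureReal_empty] at hzero
  exact hzero.mono_left
    (nhdsWithin_le_iff.2 (mem_of_superset (Ioo_mem_nhdsGT hη) Ioo_subset_Ico_self))

variable [IsFiniteMeasure μ]

theorem exists_setOf_measureReal_ball_lt_eq_ball {ρ : ℝ} (hρ : 0 ≤ ρ)
    (hcont : ContinuousOn (fun r => μ.real (ball ζ r)) (Icc 0 ρ)) {z : ℝ} (hz : 0 < z)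
    (hzρ : z ≤ μ.real (ball ζ ρ)) :
    ∃ R > 0, {x | μ.real (ball ζ (dist x ζ)) < z} = ball ζ R := by
  have hcompact : IsCompact (Icc 0 ρ ∩ (fun r => μ.real (ball ζ r)) ⁻¹' Ici z) :=
    isCompact_Icc.of_isClosed_subset (hcont.preimage_isClosed_of_isClosed isClosed_Icc isClosed_Ici)
      inter_subset_left
  obtain ⟨R, ⟨⟨hR0, hRρ⟩, hRz⟩, hRmin⟩ := hcompact.exists_isLeast ⟨ρ, ⟨hρ, le_rfl⟩, hzρ⟩
  refine ⟨R, hR0.lt_of_ne ?_, Subset.antisymm (fun x hx => ?_) fun x hx => ?_⟩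
  · rintro rfl
    rw [mem_preimage, ball_zero, measureReal_empty] at hRz
    exact hz.not_ge hRz
  · by_contra hxR
    exact (hx.trans_le hRz).not_ge (measureReal_mono (ball_subset_ball (not_lt.1 hxR)))
  · by_contra hxz
    have hzx : z ≤ μ.real (ball ζ (dist x ζ)) := not_lt.1 hxz
    exact (hRmin ⟨⟨dist_nonneg, (le_of_lt hx).trans hRρ⟩, hzx⟩).not_gt hx

theorem IsPeakFunction.exists_exceed_eq_ball {g : ℝ≥0 → EReal} (hg : IsPeakFunction g)
    (hcont : ContinuousBallMeasure μ ζ) (hpos : ∀ r > 0, 0 < μ.real (ball ζ r)) (f : M → M) :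
    ∃ η > 0, ∀ u : ℝ, (exceed f (observable μ ζ g) u 0).Nonempty →
      μ.real (exceed f (observable μ ζ g) u 0) < η →
      ∃ R > 0, exceed f (observable μ ζ g) u 0 = ball ζ R := by
  have hlim := hcont.tendsto
  obtain ⟨η₀, hη₀, hcont⟩ := hcont
  obtain ⟨v, hv, hsup⟩ := hg.exists_setOf_lt_eq_Iio
  obtain ⟨ρ, hρv, hρ0, hρη₀⟩ :=
    ((hlim.eventually_lt_const (NNReal.coe_pos.2 hv)).and (Ioo_mem_nhdsGT hη₀)).exists
  refine ⟨μ.real (ball ζ ρ), hpos ρ hρ0, fun u hne hu => ?_⟩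
  have hball : ¬ ball ζ ρ ⊆ exceed f (observable μ ζ g) u 0 := fun hsub =>
    (measureReal_mono hsub).not_gt hu
  have hmono {x : M} (hx : x ∈ ball ζ ρ) : μ.real (ball ζ (dist x ζ)) ≤ μ.real (ball ζ ρ) :=
    measureReal_mono (ball_subset_ball (le_of_lt hx))
  have hu0 : (u : EReal) < g 0 := hne.elim fun x hx => lt_of_lt_of_le hx (hg.le_apply_zero _)
  have hlow : ∃ y < v, g y ≤ u := by
    obtain ⟨x, hx, hxu⟩ := not_subset.1 hball
    exact ⟨_, NNReal.coe_lt_coe.1 ((hmono hx).trans_lt hρv), not_lt.1 hxu⟩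
  obtain ⟨z, hz, hzu⟩ := hsup u hu0 hlow
  have hexceed : exceed f (observable μ ζ g) u 0 = {x | μ.real (ball ζ (dist x ζ)) < z} := by
    ext x
    exact (Set.ext_iff.1 hzu _).trans NNReal.coe_lt_coe.symm
  rw [hexceed] at hball ⊢
  refine exists_setOf_measureReal_ball_lt_eq_ball (le_of_lt hρ0)
    (hcont.mono (Icc_subset_Ico_right hρη₀)) (NNReal.coe_pos.2 hz) ?_
  by_contra hzρ
  exact hball fun x hx => (hmono hx).trans_lt (not_le.1 hzρ)

theorem tendsto_radius {ι : Type*} {l : Filter ι} {R : ι → ℝ} (hR : ∀ᶠ i in l, 0 < R i)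
    (hpos : ∀ r > 0, 0 < μ.real (ball ζ r))
    (hR0 : Tendsto (fun i => μ.real (ball ζ (R i))) l (𝓝 0)) : Tendsto R l (𝓝[>] 0) := by
  refine tendsto_nhdsWithin_iff.2
    ⟨tendsto_order.2 ⟨fun a ha => hR.mono fun _ => ha.trans, fun a ha => ?_⟩, hR⟩
  filter_upwards [hR0.eventually_lt_const (hpos a ha)] with i hi
  by_contra haR
  exact (measureReal_mono (ball_subset_ball (not_lt.1 haR))).not_gt hi

theorem IsPeakFunction.exists_tendsto_exceed_eq_ball {g : ℝ≥0 → EReal} (hg : IsPeakFunction g)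
    (hcont : ContinuousBallMeasure μ ζ) (hpos : ∀ r > 0, 0 < μ.real (ball ζ r)) (f : M → M)
    {τ : ℝ} (hτ : 0 < τ) {u : ℕ → ℝ}
    (hu : Tendsto (fun n : ℕ => (n : ℝ) * μ.real (exceed f (observable μ ζ g) (u n) 0))
      atTop (𝓝 τ)) :
    ∃ R : ℕ → ℝ, Tendsto R atTop (𝓝[>] 0) ∧
      ∀ᶠ n in atTop, exceed f (observable μ ζ g) (u n) 0 = ball ζ (R n) := by
  obtain ⟨η, hη, hball⟩ := hg.exists_exceed_eq_ball hcont hpos f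
  have hu0 := tendsto_zero_of_tendsto_natCast_mul hu
  have hexists : ∀ᶠ n in atTop, ∃ R : ℝ, 0 < R ∧
      exceed f (observable μ ζ g) (u n) 0 = ball ζ R := by
    filter_upwards [hu.eventually_const_lt hτ, hu0.eventually_lt_const hη] with n hn hnη
    refine hball (u n) (nonempty_of_measureReal_ne_zero (μ := μ) fun h => ?_) hnη
    rw [h, mul_zero] at hn
    exact hn.false
  obtain ⟨R, hR⟩ := hexists.choice
  refine ⟨R, tendsto_radius (hR.mono fun _ => And.left) hpos (hu0.congr' ?_),
    hR.mono fun _ => And.right⟩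
  exact hR.mono fun n hn => congrArg μ.real hn.2

end ExceedanceBalls

section BallLaw

open Metric

variable {M : Type*} [MetricSpace M] [MeasurableSpace M] [OpensMeasurableSpace M] {μ : Measure M}
  {f : M → M} {ζ : M} {X : M → EReal} {p : ℕ} {τ θ ρ : ℝ} {u : ℕ → ℝ} {R : ℕ → ℝ}

theorem tendsto_natCast_mul_escape_of_return_ratio [IsFiniteMeasure μ] (hf : Measurable f)
    (hratio : Tendsto (fun r => μ.real (ball ζ r ∩ f^[p] ⁻¹' ball ζ r) / μ.real (ball ζ r))
      (𝓝[>] 0) (𝓝 ρ))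
    (hτ : τ ≠ 0) (hu : Tendsto (fun n : ℕ => (n : ℝ) * μ.real (exceed f X (u n) 0)) atTop (𝓝 τ))
    (hR0 : Tendsto R atTop (𝓝[>] 0)) (hR : ∀ᶠ n in atTop, exceed f X (u n) 0 = ball ζ (R n)) :
    Tendsto (fun n : ℕ => (n : ℝ) * μ.real (escape f X p (u n) 0)) atTop (𝓝 ((1 - ρ) * τ)) := by
  have hmul := hu.mul ((hratio.comp hR0).const_sub 1)
  rw [mul_comm τ] at hmul
  refine hmul.congr' ?_
  filter_upwards [hR, hu.eventually_ne hτ] with n hn hne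
  have hball : μ.real (ball ζ (R n)) ≠ 0 := hn ▸ right_ne_zero_of_mul hne
  have hsplit := measureReal_sdiff_add_inter (μ := μ) (s := ball ζ (R n))
    (hf.iterate p (measurableSet_ball (x := ζ) (ε := R n)))
  rw [escape_zero, hn, eq_sub_of_add_eq hsplit, Function.comp_apply, mul_assoc, mul_one_sub,
    mul_div_cancel₀ _ hball]

theorem hasSurvivalLaw_ball_of_exceed_eq_ball [IsProbabilityMeasure μ] {t : ℕ → ℕ}
    (hD : CondD μ f X p u t) (hD' : CondDPrime μ f X p u t) (hf : MeasurePreserving f μ μ)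
    (hp : 0 < p) (hτ : 0 < τ)
    (hu : Tendsto (fun n : ℕ => (n : ℝ) * μ.real (exceed f X (u n) 0)) atTop (𝓝 τ))
    (hθ : Tendsto (fun n : ℕ => (n : ℝ) * μ.real (escape f X p (u n) 0)) atTop (𝓝 (θ * τ)))
    (hR : ∀ᶠ n in atTop, exceed f X (u n) 0 = ball ζ (R n)) {ι : Type*} {l : Filter ι}
    {δ : ι → ℝ} (hδ : Tendsto (fun i => μ.real (ball ζ (δ i))) l (𝓝[>] 0)) :
    HasSurvivalLaw μ f (fun i => ball ζ (δ i)) l fun s => Real.exp (-θ * s) := by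
  let n : ι → ℕ := fun i => ⌊τ / μ.real (ball ζ (δ i))⌋₊
  have hn : Tendsto n l atTop :=
    tendsto_nat_floor_atTop.comp ((tendsto_inv_nhdsGT_zero.comp hδ).const_mul_atTop hτ)
  have hRn := hn.eventually hR
  have hlaw := hD.hasSurvivalLaw_exceed hD' hf
    (hR.mono fun k hk => hk ▸ measurableSet_ball) hp hτ.ne' hu hθ hn
  refine hlaw.of_tendsto_div_one hf (hRn.mono fun i hi => hi ▸ measurableSet_ball)
    (.of_forall fun i => measurableSet_ball) (hRn.mono fun i hi => ?_) ?_
  · rw [hi]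
    exact (le_total (R (n i)) (δ i)).imp ball_subset_ball ball_subset_ball
  · have hdiv := (hu.comp hn).div (tendsto_natFloor_div_mul hδ hτ.le) hτ.ne'
    rw [div_self hτ.ne'] at hdiv
    refine hdiv.congr' ((hn.eventually_ne_atTop 0).mono fun i hi => ?_)
    exact mul_div_mul_left _ _ (Nat.cast_ne_zero.2 hi)

theorem corollary3p4_general [StandardBorelSpace M] [IsProbabilityMeasure μ] {m : Measure M}
    {φ : M → ℝ} {c : ℝ} {g : ℝ≥0 → EReal} {t : ℕ → ℕ} {δ : ℕ → ℝ}
    (hf : MeasurePreserving f μ μ) (hφ : Measurable φ)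
    (hS : ContinuousAt (birkhoffSum f φ p) ζ) (hm : IsConformal f φ m) (hμm : μ ≪ m)
    (hζ : IsExpandingPeriodicPoint f ζ p) (hc : 0 < c) (hdens : HasDensityAt μ m ζ c)
    (hcont : ContinuousBallMeasure μ ζ) (hg : IsPeakFunction g) (hτ : 0 < τ)
    (hu : Tendsto (fun n : ℕ => (n : ℝ) * μ.real (exceed f (observable μ ζ g) (u n) 0))
      atTop (𝓝 τ))
    (hD : CondD μ f (observable μ ζ g) p u t) (hD' : CondDPrime μ f (observable μ ζ g) p u t)
    (hθ : θ = 1 - Real.exp (birkhoffSum f φ p ζ)) (hδ : ∀ n, 0 < δ n)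
    (hδ0 : Tendsto δ atTop (𝓝 0)) :
    (∀ s : ℝ, 0 ≤ s →
      Tendsto (fun n => μ.real (hitBefore μ f (ball ζ (δ n)) s))
        atTop (𝓝 (1 - Real.exp (-θ * s)))) ∧
    (∀ s : ℝ, 0 < s →
      Tendsto (fun n => (ProbabilityTheory.cond μ (ball ζ (δ n))).real
          (hitBefore μ f (ball ζ (δ n)) s))
        atTop (𝓝 ((1 - θ) + θ * (1 - Real.exp (-θ * s))))) := by
  have := hm.prob
  have hpos : ∀ r > 0, 0 < μ.real (ball ζ r) := fun r =>
    hdens.measureReal_ball_pos_of_absolutelyContinuous hc hμm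
  obtain ⟨R, hR0, hR⟩ := hg.exists_tendsto_exceed_eq_ball hcont hpos f hτ hu
  have hratio := hζ.tendsto_return_ratio hf.measurable hφ hS hm hμm hc.ne' hdens
  have hescape :=
    tendsto_natCast_mul_escape_of_return_ratio hf.measurable hratio hτ.ne' hu hR0 hR
  rw [← hθ] at hescape
  have hball : Tendsto (fun n => μ.real (ball ζ (δ n))) atTop (𝓝[>] 0) :=
    tendsto_nhdsWithin_iff.2
      ⟨hcont.tendsto.comp (tendsto_nhdsWithin_iff.2 ⟨hδ0, .of_forall hδ⟩),
        .of_forall fun n => hpos _ (hδ n)⟩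
  have hlaw := hasSurvivalLaw_ball_of_exceed_eq_ball hD hD' hf hζ.pos hτ hu hescape hR hball
  refine ⟨fun s hs => hlaw.tendsto_hitBefore hf (fun _ => measurableSet_ball) hball hs,
    fun s hs => ?_⟩
  have hderiv : HasDerivAt (fun s => Real.exp (-θ * s)) (Real.exp (-θ * s) * (-θ)) s :=
    ((hasDerivAt_id s).const_mul (-θ)).exp.congr_deriv (by rw [mul_one]; rfl)
  convert hlaw.tendsto_cond_hitBefore hf (fun _ => measurableSet_ball) hball hs hderiv using 2
  ring

end BallLaw

end EquilibriumHTS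

theorem corollary3p4
    {E : Type*} [NormedAddCommGroup E] [NormedSpace ℝ E] [FiniteDimensional ℝ E]
    {H : Type*} [TopologicalSpace H] (I : ModelWithCorners ℝ E H)
    {M : Type*} [MetricSpace M] [SecondCountableTopology M]
    [ChartedSpace H M] [IsManifold I 1 M]
    [Bundle.RiemannianBundle (fun x : M => TangentSpace I x)]
    [IsContinuousRiemannianBundle E (fun x : M => TangentSpace I x)]
    [IsRiemannianManifold I M]
    [MeasurableSpace M] [BorelSpace M]
    (f : M → M) (hf : Measurable f)
    (φ : M → ℝ) (hφ : Continuous φ) (hP : pressure f φ = 0)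
    (m μ : Measure M) (hm : IsConformal f φ m)
    (hμ : IsEquilibriumState f φ μ) (hμm : μ ≪ m)
    (ζ : M) (p : ℕ) (hζ : IsRepellingPeriodicPoint I f ζ p)
    (c : ℝ) (hc : 0 < c) (hdens : HasDensityAt μ m ζ c)
    (hcont : ContinuousBallMeasure μ ζ)
    (g : ℝ≥0 → EReal) (hg : IsPeakFunction g)
    (hdist : SummableDistortion μ f φ (observable μ ζ g) p ζ)
    (τ : ℝ) (hτ : 0 < τ) (u : ℕ → ℝ)
    (hu : Tendsto (fun n : ℕ => (n : ℝ) * μ.real (exceed f (observable μ ζ g) (u n) 0))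
      atTop (𝓝 τ))
    (t : ℕ → ℕ)
    (hD : CondD μ f (observable μ ζ g) p u t)
    (hD' : CondDPrime μ f (observable μ ζ g) p u t)
    (θ : ℝ) (hθ : θ = 1 - Real.exp (birkhoffSum f φ p ζ))
    (δ : ℕ → ℝ) (hδ : ∀ n, 0 < δ n) (hδ0 : Tendsto δ atTop (𝓝 0)) :
    (∀ s : ℝ, 0 ≤ s →
      Tendsto (fun n => μ.real (hitBefore μ f (Metric.ball ζ (δ n)) s))
        atTop (𝓝 (1 - Real.exp (-θ * s)))) ∧
    (∀ s : ℝ, 0 < s →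
      Tendsto (fun n => (ProbabilityTheory.cond μ (Metric.ball ζ (δ n))).real
          (hitBefore μ f (Metric.ball ζ (δ n)) s))
        atTop (𝓝 ((1 - θ) + θ * (1 - Real.exp (-θ * s))))) := by
  have := hμ.prob
  have : LocallyCompactSpace H := I.locallyCompactSpace
  have : LocallyCompactSpace M := ChartedSpace.locallyCompactSpace H M
  have := polishSpace_of_weaklyLocallyCompactSpace M
  exact corollary3p4_general hμ.invariant hφ.measurable (hζ.continuousAt_birkhoffSum hφ) hm hμm
    hζ.isExpandingPeriodicPoint hc hdens hcont hg hτ hu hD hD' hθ hδ hδ0
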